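/- Let $W\subset\mathbb{CP}^n$ be a smooth rational curve of degree $d$, that is, an irreducible projective variety of dimension one which is smooth, birational to $\mathbb{CP}^1$, and met by a general hyperplane in exactly $d$ points ($d\ge 1$). Let $C(W)\subset\mathbb C^{n+1}$ be the affine cone over $W$, i.e. the union of the complex lines through the origin that correspond to the points of $W$, and let $L=\{x\in C(W):\|x\|=1\}$ be its link at $0$, where $\|\cdot\|$ is the standard Hermitian norm. Then $L$ is a smoothly embedded (real) $3$-dimensional submanifold of $\mathbb C^{n+1}$, and it is diffeomorphic to the lens space $L(d,1)$, the quotient of the unit sphere $S^3\subset\mathbb C^2$ by the free $\mathbb Z/d$-action generated by $(z_1,z_2)\mapsto(e^{2\pi i/d}z_1,e^{2\pi i/d}z_2)$. -/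

import Mathlib

open scoped Manifold ContDiff

-- This instance, an identity wrapper, would otherwise apply to every charted space.
attribute [-instance] TopCat.of.chartedSpace TopCat.of.hasGroupoid

noncomputable section

/-! ### Complex projective space, affine cones and their links -/

/-- The affine space `ℂᵐ` with its standard Hermitian norm. -/
abbrev AffSp (m : ℕ) : Type := EuclideanSpace ℂ (Fin m)

/-- Complex projective space `ℂPⁿ`, the space of lines through the origin of `ℂⁿ⁺¹`. -/
abbrev CP (n : ℕ) : Type := Projectivization ℂ (AffSp (n + 1))

/-- The affine cone `C(W) ⊆ ℂⁿ⁺¹` over `W ⊆ ℂPⁿ`: the union of the (affine) lines through the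
origin which are the points of `W`. -/
def affineCone {n : ℕ} (W : Set (CP n)) : Set (AffSp (n + 1)) :=
  ⋃ p ∈ W, (p.submodule : Set (AffSp (n + 1)))

/-- The link at the origin of the affine cone over `W`: its points of norm one. -/
def link {n : ℕ} (W : Set (CP n)) : Set (AffSp (n + 1)) :=
  {x | x ∈ affineCone W ∧ ‖x‖ = 1}

/-! ### Projective varieties -/

/-- The homogeneous coordinate ring `ℂ[X₀, …, Xₙ]` of `ℂPⁿ`. -/
abbrev CoordRing (n : ℕ) : Type := MvPolynomial (Fin (n + 1)) ℂ

/-- The homogeneous ideal `I(W)` of `W ⊆ ℂPⁿ`: all polynomials vanishing on the affine cone over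
`W`. (As `ℂ` is infinite, this is the ideal generated by the homogeneous polynomials which vanish
on `W`.) -/
def idealOf {n : ℕ} (W : Set (CP n)) : Ideal (CoordRing n) where
  carrier := {F | ∀ x ∈ affineCone W, MvPolynomial.eval x.ofLp F = 0}
  zero_mem' _ _ := map_zero _
  add_mem' hF hG x hx := by rw [map_add, hF x hx, hG x hx, add_zero]
  smul_mem' c F hF x hx := by rw [smul_eq_mul, map_mul, hF x hx, mul_zero]

/-- `W ⊆ ℂPⁿ` is the set of common zeros of a family of homogeneous polynomials. -/
def IsProjectiveAlgebraicSet {n : ℕ} (W : Set (CP n)) : Prop :=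
  ∃ S : Set (CoordRing n), (∀ F ∈ S, ∃ m : ℕ, F.IsHomogeneous m) ∧
    W = {p : CP n | ∀ F ∈ S, MvPolynomial.eval p.rep.ofLp F = 0}

/-- `W ⊆ ℂPⁿ` is a projective curve: an irreducible projective variety of dimension one.
Irreducibility (which includes `W ≠ ∅`) says that the homogeneous ideal is prime, and
the dimension of `W` is one less than that of its homogeneous coordinate ring. -/
structure IsProjectiveCurve {n : ℕ} (W : Set (CP n)) : Prop where
  isAlgebraic : IsProjectiveAlgebraicSet W
  isPrime : (idealOf W).IsPrime
  dim_eq : ringKrullDim (CoordRing n ⧸ idealOf W) = 2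

/-- The gradient at `x` of a polynomial `F`. -/
def gradAt {n : ℕ} (F : CoordRing n) (x : AffSp (n + 1)) : Fin (n + 1) → ℂ :=
  fun i => MvPolynomial.eval x.ofLp (MvPolynomial.pderiv i F)

/-- Smoothness of a projective curve in `ℂPⁿ` by the Jacobian criterion: at each point of `W`
the gradients of the elements of the homogeneous ideal have rank `n - 1`. -/
def IsSmoothCurve {n : ℕ} (W : Set (CP n)) : Prop :=
  IsProjectiveCurve W ∧ ∀ p ∈ W,
    Module.finrank ℂ (Submodule.span ℂ ((fun F => gradAt F p.rep) '' (idealOf W : Set _))) + 1 = n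

/-- Evaluation at a vector of a tuple of polynomials. -/
def evalForms {m n : ℕ} (f : Fin (n + 1) → CoordRing m) (x : AffSp (m + 1)) : AffSp (n + 1) :=
  WithLp.toLp 2 fun i => MvPolynomial.eval x.ofLp (f i)

/-- `V ⊆ ℂPᵐ` and `W ⊆ ℂPⁿ` (irreducible projective varieties) are birational: there are
rational maps `V ⇢ W` and `W ⇢ V`, each given by a tuple of homogeneous polynomials of the same
degree, that can be composed in both orders and are inverse to each other wherever the compositions
are defined. All conditions are stated on homogeneous coordinates, that is, on affine cones. -/
def AreBirational {m n : ℕ} (V : Set (CP m)) (W : Set (CP n)) : Prop :=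
  ∃ (a b : ℕ) (f : Fin (n + 1) → CoordRing m) (g : Fin (m + 1) → CoordRing n),
    (∀ i, (f i).IsHomogeneous a) ∧ (∀ j, (g j).IsHomogeneous b) ∧
    (∀ x ∈ affineCone V, evalForms f x ∈ affineCone W) ∧
    (∀ y ∈ affineCone W, evalForms g y ∈ affineCone V) ∧
    (∀ x ∈ affineCone V, ∃ c : ℂ, evalForms g (evalForms f x) = c • x) ∧
    (∀ y ∈ affineCone W, ∃ c : ℂ, evalForms f (evalForms g y) = c • y) ∧
    (∃ x ∈ affineCone V, evalForms f x ≠ 0 ∧ evalForms g (evalForms f x) ≠ 0) ∧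
    (∃ y ∈ affineCone W, evalForms g y ≠ 0 ∧ evalForms f (evalForms g y) ≠ 0)

/-- A smooth rational curve in `ℂPⁿ`: a smooth projective curve birational to `ℂP¹`. -/
structure IsSmoothRationalCurve {n : ℕ} (W : Set (CP n)) : Prop where
  isSmooth : IsSmoothCurve W
  isRational : AreBirational (Set.univ : Set (CP 1)) W

/-- The projective curve `W ⊆ ℂPⁿ` has degree `d`: a general hyperplane `∑ aᵢ Xᵢ = 0` meets `W`
in exactly `d` points. Here "general" means that the coefficient vector `a` lies outside the zero
set of some nonzero polynomial. -/
def HasDegree {n : ℕ} (W : Set (CP n)) (d : ℕ) : Prop :=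
  ∃ G : CoordRing n, G ≠ 0 ∧ ∀ a : Fin (n + 1) → ℂ, MvPolynomial.eval a G ≠ 0 →
    {p : CP n | p ∈ W ∧ ∑ i, a i * p.rep.ofLp i = 0}.encard = d

/-! ### Lens spaces -/

/-- The unit sphere `S³ ⊆ ℂ²`. -/
abbrev S3 : Type := Metric.sphere (0 : AffSp 2) 1

instance instFactFinrank : Fact (Module.finrank ℝ (AffSp 2) = 3 + 1) :=
  ⟨by rw [← Module.finrank_mul_finrank ℝ ℂ (AffSp 2)]; simp⟩

/-- Linear isometries of `ℂ²` act on `S³`. -/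
instance instMulActionS3 : MulAction (AffSp 2 ≃ₗᵢ[ℝ] AffSp 2) S3 where
  smul g x := ⟨g x, by simp⟩
  one_smul _ := rfl
  mul_smul _ _ _ := rfl

/-- The isometry `(z₁, z₂) ↦ (e^{2πi/p} z₁, e^{2πiq/p} z₂)` of `ℂ²`. -/
def lensRotation (p : ℕ) (q : ℤ) : AffSp 2 ≃ₗᵢ[ℝ] AffSp 2 :=
  LinearIsometryEquiv.piLpCongrRight 2
    ![rotation (Circle.exp (2 * Real.pi / p)), rotation (Circle.exp (2 * Real.pi * q / p))]

/-- The group generated by `lensRotation p q`, which is cyclic of order `p`. -/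
abbrev lensGroup (p : ℕ) (q : ℤ) : Subgroup (AffSp 2 ≃ₗᵢ[ℝ] AffSp 2) :=
  Subgroup.zpowers (lensRotation p q)

/-- The lens space `L(p, q)` as a topological space: the quotient of `S³` by the action
of the group generated by `(z₁, z₂) ↦ (e^{2πi/p} z₁, e^{2πiq/p} z₂)`. -/
abbrev LensSpace (p : ℕ) (q : ℤ) : Type :=
  MulAction.orbitRel.Quotient (lensGroup p q) S3

theorem lensRotation_apply (p : ℕ) (q : ℤ) (z : AffSp 2) :
    lensRotation p q z =
      !₂[Complex.exp (2 * Real.pi * Complex.I / p) * z 0,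
        Complex.exp (2 * Real.pi * Complex.I * q / p) * z 1] := by
  ext i
  fin_cases i
  · simp [lensRotation, LinearIsometryEquiv.piLpCongrRight_apply, rotation_apply, Circle.coe_exp]
    left; congr 1; ring
  · simp [lensRotation, LinearIsometryEquiv.piLpCongrRight_apply, rotation_apply, Circle.coe_exp]
    left; congr 1; ring

theorem lensRotation_pow_apply (p : ℕ) (q : ℤ) (k : ℕ) (z : AffSp 2) :
    (lensRotation p q ^ k) z =
      !₂[Complex.exp (2 * Real.pi * Complex.I / p) ^ k * z 0,
        Complex.exp (2 * Real.pi * Complex.I * q / p) ^ k * z 1] := by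
  induction k with
  | zero => ext i; fin_cases i <;> simp
  | succ k ih =>
    rw [pow_succ', LinearIsometryEquiv.coe_mul, Function.comp_apply, ih, lensRotation_apply]
    ext i; fin_cases i <;> simp [pow_succ'] <;> ring

theorem lensRotation_pow_self (p : ℕ) [NeZero p] (q : ℤ) : lensRotation p q ^ p = 1 := by
  have hp : (p : ℂ) ≠ 0 := NeZero.ne _
  have h0 : Complex.exp (2 * Real.pi * Complex.I / p) ^ p = 1 := by
    rw [← Complex.exp_nat_mul, mul_div_cancel₀ _ hp, Complex.exp_two_pi_mul_I]
  have h1 : Complex.exp (2 * Real.pi * Complex.I * q / p) ^ p = 1 := by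
    rw [← Complex.exp_nat_mul, mul_div_cancel₀ _ hp, mul_comm]
    exact Complex.exp_int_mul_two_pi_mul_I q
  ext z i
  rw [lensRotation_pow_apply, h0, h1]
  fin_cases i <;> simp

instance instFiniteLensGroup (p : ℕ) [NeZero p] (q : ℤ) : Finite (lensGroup p q) :=
  (isOfFinOrder_iff_pow_eq_one.2 ⟨p, NeZero.pos p, lensRotation_pow_self p q⟩).finite_zpowers

instance instContinuousConstSMulS3 (p : ℕ) (q : ℤ) : ContinuousConstSMul (lensGroup p q) S3 :=
  ⟨fun g => (g.1.continuous.comp continuous_subtype_val).subtype_mk _⟩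

instance instFactIsCoprimeOne (p : ℤ) : Fact (IsCoprime p 1) := ⟨isCoprime_one_right⟩

/-- For coprime `p` and `q` the action on `S³` is free. -/
instance instIsCancelSMulS3 (p : ℕ) [NeZero p] (q : ℤ) [hq : Fact (IsCoprime (p : ℤ) q)] :
    IsCancelSMul (lensGroup p q) S3 where
  right_cancel' g h x hx := by
    have hp : (p : ℂ) ≠ 0 := NeZero.ne _
    have key : ∀ u : lensGroup p q, u • x = x → u = 1 := by
      rintro ⟨u, hu⟩ hux
      obtain ⟨k, rfl⟩ := (isOfFinOrder_iff_pow_eq_one.2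
        ⟨p, NeZero.pos p, lensRotation_pow_self p q⟩).mem_powers_iff_mem_zpowers.2 hu
      have hux' : (lensRotation p q ^ k) x.1 = x.1 := congrArg Subtype.val hux
      have hz : x.1 0 ≠ 0 ∨ x.1 1 ≠ 0 := by
        by_contra! hcon
        have : x.1 = 0 := by ext i; fin_cases i <;> simp [hcon]
        have h1 := x.2
        rw [this] at h1
        simp at h1
      rw [lensRotation_pow_apply] at hux'
      have e0 := congrArg (fun v : AffSp 2 => v 0) hux'
      have e1 := congrArg (fun v : AffSp 2 => v 1) hux'
      have aux : ∀ r : ℤ, IsCoprime (p : ℤ) r →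
          Complex.exp (2 * Real.pi * Complex.I * r / p) ^ k = 1 → p ∣ k := by
        intro r hr he
        rw [← Complex.exp_nat_mul, Complex.exp_eq_one_iff] at he
        obtain ⟨m, hm⟩ := he
        have h2 : (k : ℂ) * r = m * p := by
          field_simp at hm
          linear_combination hm
        have h3 : (p : ℤ) ∣ k * r := ⟨m, by rw [mul_comm (p : ℤ)]; exact_mod_cast h2⟩
        exact Int.natCast_dvd_natCast.1 (hr.dvd_of_dvd_mul_right h3)
      have hk : p ∣ k := by
        rcases hz with hz | hz
        · refine aux 1 isCoprime_one_right ?_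
          simpa [hz] using e0
        · refine aux q hq.out ?_
          simpa [hz] using e1
      obtain ⟨m, rfl⟩ := hk
      apply Subtype.ext
      change lensRotation p q ^ (p * m) = 1
      rw [pow_mul, lensRotation_pow_self, one_pow]
    have h1 : (h⁻¹ * g) • x = x := by rw [mul_smul, hx, inv_smul_smul]
    exact (inv_mul_eq_one.1 (key _ h1)).symm

/-- The charts of `L(p, q)` are those of Mathlib's quotient of a manifold by a free and properly
discontinuous action: local inverses of the quotient map followed by charts of `S³`. -/
instance instChartedSpaceLensSpace (p : ℕ) [NeZero p] (q : ℤ) [Fact (IsCoprime (p : ℤ) q)] :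
    ChartedSpace (EuclideanSpace ℝ (Fin 3)) (LensSpace p q) :=
  MulAction.instChartedSpaceQuotient

theorem contMDiff_smul_S3 (p : ℕ) (q : ℤ) (g : lensGroup p q) :
    ContMDiff (𝓡 3) (𝓡 3) ω (fun x : S3 => g • x) := by
  have h : ContMDiff (𝓡 3) 𝓘(ℝ, AffSp 2) ω (fun x : S3 => g.1 (x : AffSp 2)) :=
    g.1.toContinuousLinearEquiv.contDiff.contMDiff.comp contMDiff_coe_sphere
  exact h.codRestrict_sphere _

/-- The quotient map `S³ → L(p, q)`. -/
def lensMk (p : ℕ) (q : ℤ) (x : S3) : LensSpace p q := Quotient.mk _ x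

theorem lensMk_eq_iff (p : ℕ) (q : ℤ) (x y : S3) :
    lensMk p q x = lensMk p q y ↔ ∃ g : lensGroup p q, g • y = x :=
  Quotient.eq''

theorem isLocalHomeomorph_lensMk (p : ℕ) [NeZero p] (q : ℤ) [Fact (IsCoprime (p : ℤ) q)] :
    IsLocalHomeomorph (lensMk p q) :=
  (isQuotientCoveringMap_quotientMk_of_properlyDiscontinuousSMul
    (G := lensGroup p q) (E := S3)).isCoveringMap.isLocalHomeomorph

theorem contMDiffAt_localInverseAt_lensMk (p : ℕ) [NeZero p] (q : ℤ) [Fact (IsCoprime (p : ℤ) q)]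
    (b u : S3)
    (hu : lensMk p q u ∈ ((isLocalHomeomorph_lensMk p q).localInverseAt b).source) :
    ContMDiffAt (𝓡 3) (𝓡 3) ω
      (fun v => (isLocalHomeomorph_lensMk p q).localInverseAt b (lensMk p q v)) u := by
  set hπ := isLocalHomeomorph_lensMk p q
  obtain ⟨g, hg⟩ := (lensMk_eq_iff p q _ _).1 (hπ.apply_localInverseAt_of_mem hu)
  refine (contMDiff_smul_S3 p q g).contMDiffAt.congr_of_eventuallyEq ?_
  have hc : Continuous (fun v : S3 => g • v) := continuous_const_smul g
  have h1 : ∀ᶠ v in nhds u, g • v ∈ (hπ.localInverseAt b).target := by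
    refine hc.continuousAt.eventually_mem ((hπ.localInverseAt b).open_target.mem_nhds ?_)
    rw [hg]
    exact (hπ.localInverseAt b).map_source hu
  filter_upwards [h1] with v hv
  have h2 : lensMk p q v = lensMk p q (g • v) :=
    (lensMk_eq_iff p q _ _).2 ⟨g⁻¹, inv_smul_smul g v⟩
  rw [h2]
  have h3 := (hπ.localInverseAt b).right_inv hv
  rwa [hπ.localInverseAt_symm] at h3

/-- `L(p, q)` is a smooth (indeed analytic) manifold. -/
instance instIsManifoldLensSpace (p : ℕ) [NeZero p] (q : ℤ) [Fact (IsCoprime (p : ℤ) q)] :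
    IsManifold (𝓡 3) ω (LensSpace p q) := by
  have hπ := isLocalHomeomorph_lensMk p q
  have key : ∀ (a b : S3),
      ContDiffOn ℝ ω
        ((((hπ.localInverseAt a).trans (chartAt (EuclideanSpace ℝ (Fin 3)) a)).symm).trans
          ((hπ.localInverseAt b).trans (chartAt (EuclideanSpace ℝ (Fin 3)) b)))
        ((((hπ.localInverseAt a).trans (chartAt (EuclideanSpace ℝ (Fin 3)) a)).symm).trans
          ((hπ.localInverseAt b).trans (chartAt (EuclideanSpace ℝ (Fin 3)) b))).source := by
    intro a b
    rw [← contMDiffOn_iff_contDiffOn]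
    intro w hw
    simp only [OpenPartialHomeomorph.trans_symm_eq_symm_trans_symm,
      OpenPartialHomeomorph.trans_source, OpenPartialHomeomorph.symm_source, Set.mem_inter_iff,
      Set.mem_preimage, OpenPartialHomeomorph.coe_trans, Function.comp_apply,
      hπ.localInverseAt_symm] at hw
    obtain ⟨⟨hw1, hw2⟩, hw3, hw4⟩ := hw
    have e1 : ContMDiffAt (𝓡 3) (𝓡 3) ω (chartAt (EuclideanSpace ℝ (Fin 3)) a).symm w :=
      (contMDiffOn_chart_symm (I := 𝓡 3) (n := ω) (x := a)).contMDiffAt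
        ((chartAt (EuclideanSpace ℝ (Fin 3)) a).open_target.mem_nhds hw1)
    have e2 := contMDiffAt_localInverseAt_lensMk p q b _ hw3
    have e3 : ContMDiffAt (𝓡 3) (𝓡 3) ω (chartAt (EuclideanSpace ℝ (Fin 3)) b) _ :=
      (contMDiffOn_chart (I := 𝓡 3) (n := ω) (x := b)).contMDiffAt
        ((chartAt (EuclideanSpace ℝ (Fin 3)) b).open_source.mem_nhds hw4)
    have e4 := ContMDiffAt.comp w e3 (ContMDiffAt.comp w e2 e1)
    refine ContMDiffAt.contMDiffWithinAt (e4.congr_of_eventuallyEq (.of_eq ?_))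
    ext1 v
    simp [OpenPartialHomeomorph.trans_symm_eq_symm_trans_symm]
  apply isManifold_of_contDiffOn
  rintro _ _ ⟨x, rfl⟩ ⟨y, rfl⟩
  simp only [modelWithCornersSelf_coe, modelWithCornersSelf_coe_symm, Set.range_id, Set.inter_univ,
    Set.preimage_id, CompTriple.comp_eq]
  exact key _ _

/-- The smooth structure of `L(p, q)` is the one for which the quotient map from `S³` is a local
diffeomorphism. -/
theorem isLocalDiffeomorph_lensMk (p : ℕ) [NeZero p] (q : ℤ) [Fact (IsCoprime (p : ℤ) q)] :
    IsLocalDiffeomorph (𝓡 3) (𝓡 3) ω (lensMk p q) := by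
  have hπ := isLocalHomeomorph_lensMk p q
  have hchart : ∀ y : LensSpace p q, ∃ c : S3, lensMk p q c = y ∧
      chartAt (EuclideanSpace ℝ (Fin 3)) y =
        (hπ.localInverseAt c).trans (chartAt (EuclideanSpace ℝ (Fin 3)) c) := fun y =>
    ⟨_, Quotient.mk_surjective.hasRightInverse.choose_spec y, rfl⟩
  intro x
  refine ⟨⟨(hπ.localInverseAt x).symm.toPartialEquiv, (hπ.localInverseAt x).open_target,
    (hπ.localInverseAt x).open_source, ?_, ?_⟩, hπ.self_mem_localInverseAt_target, ?_⟩
  · intro u _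
    refine ContMDiffAt.contMDiffWithinAt ?_
    change ContMDiffAt (𝓡 3) (𝓡 3) ω (hπ.localInverseAt x).symm u
    rw [hπ.localInverseAt_symm, contMDiffAt_iff_target]
    refine ⟨hπ.continuous.continuousAt, ?_⟩
    obtain ⟨c, hc, hch⟩ := hchart (lensMk p q u)
    have hmem := mem_chart_source (EuclideanSpace ℝ (Fin 3)) (lensMk p q u)
    rw [hch, OpenPartialHomeomorph.trans_source] at hmem
    simp only [extChartAt, hch, mfld_simps]
    exact ContMDiffAt.comp u (f := fun v => hπ.localInverseAt c (lensMk p q v))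
      ((contMDiffOn_chart (I := 𝓡 3) (n := ω) (x := c)).contMDiffAt
      ((chartAt (EuclideanSpace ℝ (Fin 3)) c).open_source.mem_nhds hmem.2))
      (contMDiffAt_localInverseAt_lensMk p q c u hmem.1)
  · intro y hy
    refine ContMDiffAt.contMDiffWithinAt ?_
    change ContMDiffAt (𝓡 3) (𝓡 3) ω (hπ.localInverseAt x) y
    rw [contMDiffAt_iff_source]
    refine ContMDiffAt.contMDiffWithinAt ?_
    obtain ⟨c, rfl, hch⟩ := hchart y
    have hmem := mem_chart_target (EuclideanSpace ℝ (Fin 3)) (lensMk p q c)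
    have hinv := (chartAt (EuclideanSpace ℝ (Fin 3)) (lensMk p q c)).left_inv
      (mem_chart_source (EuclideanSpace ℝ (Fin 3)) (lensMk p q c))
    rw [hch] at hmem hinv
    simp only [OpenPartialHomeomorph.trans_target, OpenPartialHomeomorph.coe_trans,
      OpenPartialHomeomorph.coe_trans_symm, hπ.localInverseAt_symm, Function.comp_apply] at hmem hinv
    simp only [extChartAt, hch, mfld_simps, hπ.localInverseAt_symm, Function.comp_apply]
    refine ContMDiffAt.comp _ (g := fun v => hπ.localInverseAt x (lensMk p q v))
      (contMDiffAt_localInverseAt_lensMk p q x _ ?_)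
      ((contMDiffOn_chart_symm (I := 𝓡 3) (n := ω) (x := c)).contMDiffAt
        ((chartAt (EuclideanSpace ℝ (Fin 3)) c).open_target.mem_nhds ?_))
    · simpa using hy
    · simp
  · intro u _
    exact (congrFun (hπ.localInverseAt_symm x) u).symm

end

noncomputable section

open MvPolynomial

/-! ### Homogeneous forms -/

/-! A rational curve is parametrized by a tuple `F` of binary forms of one degree `e`, with a tuple
`g` of forms as rational left inverse: `g (F x)` is parallel to `x`. Choosing `e` minimal removes
common zeros, since a common zero splits off a linear factor (`IsParam.exists_pred`). The map `F :
ℂ² → C(W)` then has three properties.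

It is onto: by the Nullstellensatz, forms without common zeros make `ℂ[s, t]` finite over `ℂ[X₀, …,
Xₙ]`, and lying over produces a preimage of each point of the cone (`IsParam.exists_evalForms_eq`).

It is an immersion away from `0`, and `F x' = c F x` with `x` and `c` nonzero only if `x' = a x`
with `a ^ e = c`. This is where smoothness enters. The Jacobian criterion makes the tangent space of
the cone two-dimensional, so near a nonzero point two linear coordinates `l₀`, `l₁` determine the
points of the cone, and a branch `t ↦ F (z + t w)` is described by the function `l₁ / l₀` of one
complex variable. The left inverse `g` separates generic points. Hence this function is injective
near `0` off `0`, so its derivative does not vanish (`IsParam.coord_fderiv_ne_zero`); and two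
different branches cannot pass through one point, as both coordinates would be open at `0` and the
branches would share nearby points (`IsParam.cross_eq_of_evalForms_eq`).

Its degree is `d`: hyperplane sections correspond to roots of the pulled-back binary form, and a
general member of a suitable pencil has `e` simple roots (`IsParam.degree_eq`).

Therefore `x ↦ F x / ‖F x‖` is an immersion of `S³` onto the link, because the kernel of its
derivative on `ℂ²` is radial, and its fibres are the orbits of the `d`-th roots of unity. It
descends to a homeomorphism from `L(d, 1)`, along which the smooth structure is transported; the
inclusion of the link is an immersion because its composite with the local diffeomorphism from `S³`
is one. -/

theorem homogeneousComponent_add_mul {σ R : Type*} [CommSemiring R] {m : ℕ}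
    {P : MvPolynomial σ R} (hP : P.IsHomogeneous m) (Q : MvPolynomial σ R) (k : ℕ) :
    homogeneousComponent (m + k) (P * Q) = P * homogeneousComponent k Q := by
  conv_lhs => rw [← sum_homogeneousComponent Q, Finset.mul_sum, map_sum]
  have h1 : ∀ i, homogeneousComponent (m + k) (P * homogeneousComponent i Q) =
      if i = k then P * homogeneousComponent k Q else 0 := by
    intro i
    rw [homogeneousComponent_of_mem (m := m + k) (n := m + i)
      (hP.mul (homogeneousComponent_isHomogeneous i Q))]
    rcases eq_or_ne i k with rfl | h
    · simp
    · rw [if_neg h, if_neg (by omega)]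
  rw [Finset.sum_congr rfl fun i _ => h1 i, Finset.sum_ite_eq']
  split_ifs with h
  · rfl
  · rw [homogeneousComponent_eq_zero _ _ (by simpa using h), mul_zero]

theorem eval_aeval {σ τ R : Type*} [CommRing R] (x : τ → R) (g : σ → MvPolynomial τ R)
    (P : MvPolynomial σ R) :
    eval x (aeval g P) = eval (fun j => eval x (g j)) P := by
  induction P using MvPolynomial.induction_on with
  | C a => simp
  | add p q hp hq => rw [map_add, map_add, map_add, hp, hq]
  | mul_X p j hp => rw [map_mul, map_mul, map_mul, hp, aeval_X, eval_X]

theorem eval_smul_of_isHomogeneous {σ R : Type*} [CommRing R] {m : ℕ} {P : MvPolynomial σ R}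
    (hP : P.IsHomogeneous m) (c : R) (x : σ → R) : eval (c • x) P = c ^ m * eval x P := by
  rw [eval_eq, eval_eq, Finset.mul_sum]
  refine Finset.sum_congr rfl fun d hd => ?_
  have h1 := hP.degree_eq_sum_deg_support hd
  simp only [Pi.smul_apply, smul_eq_mul, mul_pow, Finset.prod_mul_distrib]
  rw [Finset.prod_pow_eq_pow_sum, ← h1]
  ring

theorem evalForms_smul {m n e : ℕ} {F : Fin (n + 1) → CoordRing m}
    (hF : ∀ i, (F i).IsHomogeneous e) (c : ℂ) (x : AffSp (m + 1)) :
    evalForms F (c • x) = c ^ e • evalForms F x := by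
  ext i
  simpa [evalForms] using eval_smul_of_isHomogeneous (hF i) c x.ofLp

/-! ### Affine cones and their equations. -/

theorem affineCone_univ {n : ℕ} : affineCone (Set.univ : Set (CP n)) = Set.univ := by
  ext x
  simp only [affineCone, Set.mem_univ, Set.iUnion_true, Set.mem_iUnion, iff_true]
  by_cases hx : x = 0
  · obtain ⟨v, hv⟩ := exists_ne (0 : AffSp (n + 1))
    exact ⟨Projectivization.mk ℂ v hv, by simp [hx]⟩
  · exact ⟨Projectivization.mk ℂ x hx, by simp [Projectivization.submodule_mk]⟩

theorem mem_affineCone_iff {n : ℕ} {W : Set (CP n)} {x : AffSp (n + 1)} (hx : x ≠ 0) :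
    x ∈ affineCone W ↔ Projectivization.mk ℂ x hx ∈ W := by
  simp only [affineCone, Set.mem_iUnion, SetLike.mem_coe, exists_prop]
  constructor
  · rintro ⟨p, hp, hxp⟩
    rw [Projectivization.submodule_eq, Submodule.mem_span_singleton] at hxp
    obtain ⟨a, ha⟩ := hxp
    convert hp
    rw [← p.mk_rep, Projectivization.mk_eq_mk_iff']
    exact ⟨a, ha⟩
  · exact fun h => ⟨_, h, by simp [Projectivization.submodule_mk]⟩

theorem rep_mem_affineCone {n : ℕ} {W : Set (CP n)} {p : CP n} (hp : p ∈ W) :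
    p.rep ∈ affineCone W := by
  rw [mem_affineCone_iff p.rep_nonzero, p.mk_rep]
  exact hp

theorem smul_mem_affineCone {n : ℕ} {W : Set (CP n)} {x : AffSp (n + 1)} (hx : x ∈ affineCone W)
    (c : ℂ) : c • x ∈ affineCone W := by
  simp only [affineCone, Set.mem_iUnion, SetLike.mem_coe, exists_prop] at hx ⊢
  obtain ⟨p, hp, hxp⟩ := hx
  exact ⟨p, hp, Submodule.smul_mem _ c hxp⟩

theorem nonempty_of_isPrime_idealOf {n : ℕ} {W : Set (CP n)} (h : (idealOf W).IsPrime) :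
    W.Nonempty := by
  rw [Set.nonempty_iff_ne_empty]
  rintro rfl
  refine h.ne_top ((Ideal.eq_top_iff_one _).2 fun x hx => ?_)
  simp [affineCone] at hx

/-- Homogeneous equations of `W` hold on whole lines, so they belong to the ideal and already cut
out the cone. The origin lies in the cone because a prime ideal forces `W` to be nonempty. -/
theorem mem_affineCone_iff_forall_eval {n : ℕ} {W : Set (CP n)} (hW : IsProjectiveCurve W)
    (x : AffSp (n + 1)) :
    x ∈ affineCone W ↔ ∀ H ∈ idealOf W, eval x.ofLp H = 0 := by
  refine ⟨fun hx H hH => hH x hx, fun h => ?_⟩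
  by_cases hx : x = 0
  · obtain ⟨p, hp⟩ := nonempty_of_isPrime_idealOf hW.isPrime
    rw [hx, ← zero_smul ℂ p.rep]
    exact smul_mem_affineCone (rep_mem_affineCone hp) 0
  rw [mem_affineCone_iff hx]
  obtain ⟨S, hS, rfl⟩ := hW.isAlgebraic
  intro H hH
  obtain ⟨m, hm⟩ := hS H hH
  have hmem : H ∈ idealOf {p : CP n | ∀ F ∈ S, eval p.rep.ofLp F = 0} := by
    intro y hy
    simp only [affineCone, Set.mem_iUnion, SetLike.mem_coe, exists_prop] at hy
    obtain ⟨p, hp, hyp⟩ := hy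
    rw [Projectivization.submodule_eq, Submodule.mem_span_singleton] at hyp
    obtain ⟨a, rfl⟩ := hyp
    have := eval_smul_of_isHomogeneous hm a p.rep.ofLp
    simp only [WithLp.ofLp_smul]
    rw [this, hp H hH, mul_zero]
  obtain ⟨a, ha⟩ := Projectivization.exists_smul_eq_mk_rep ℂ x hx
  rw [← ha]
  have := eval_smul_of_isHomogeneous hm (a : ℂ) x.ofLp
  change eval ((a : ℂ) • x).ofLp H = 0
  rw [WithLp.ofLp_smul, this, h H hmem, mul_zero]

/-- A binary form vanishing at a point is divisible by the corresponding linear form. -/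
theorem exists_eq_linear_mul {e : ℕ} {P : CoordRing 1} (hP : P.IsHomogeneous (e + 1))
    {s : Fin 2 → ℂ} (hs : s ≠ 0) (h : eval s P = 0) :
    ∃ Q : CoordRing 1, Q.IsHomogeneous e ∧ P = (C (s 1) * X 0 - C (s 0) * X 1) * Q := by
  set l : CoordRing 1 := C (s 1) * X 0 - C (s 0) * X 1 with hl
  have hl1 : l.IsHomogeneous 1 :=
    (isHomogeneous_C_mul_X _ _).sub (isHomogeneous_C_mul_X _ _)
  obtain ⟨i, hi⟩ : ∃ i, s i ≠ 0 := by
    by_contra! hc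
    exact hs (funext hc)
  -- Putting `X j = (s j / s i) X i` amounts to evaluating at multiples of `s`, which gives zero by
  -- homogeneity; modulo `l` the substitution changes nothing, so `l` divides `P`.
  have hzero : aeval (fun j => C (s j / s i) * X i : Fin 2 → CoordRing 1) P = 0 := by
    apply MvPolynomial.funext
    intro x
    have h1 : eval x (aeval (fun j => C (s j / s i) * X i : Fin 2 → CoordRing 1) P) =
        eval ((x i / s i) • s) P := by
      rw [eval_aeval]
      congr 2
      ext j
      simp
      ring
    rw [h1, eval_smul_of_isHomogeneous hP, h, mul_zero, map_zero]
  have hdvd : l ∣ P := by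
    rw [← Ideal.mem_span_singleton, ← Ideal.Quotient.eq_zero_iff_mem]
    have hX : ∀ j, Ideal.Quotient.mk (Ideal.span {l}) (X j) =
        Ideal.Quotient.mk (Ideal.span {l}) (C (s j / s i) * X i) := by
      intro j
      rw [Ideal.Quotient.eq, Ideal.mem_span_singleton]
      by_cases hji : j = i
      · subst hji; simp [div_self hi]
      · fin_cases i <;> fin_cases j <;> simp at hji hi ⊢
        · refine ⟨-C (1 / s 0), ?_⟩
          have : (C (s 0) : CoordRing 1) * C (1 / s 0) = 1 := by
            rw [← C_mul, mul_one_div_cancel hi, C_1]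
          rw [hl, div_eq_mul_one_div, C_mul]
          linear_combination -(X 1 : CoordRing 1) * this
        · refine ⟨C (1 / s 1), ?_⟩
          have : (C (s 1) : CoordRing 1) * C (1 / s 1) = 1 := by
            rw [← C_mul, mul_one_div_cancel hi, C_1]
          rw [hl, div_eq_mul_one_div, C_mul]
          linear_combination -(X 0 : CoordRing 1) * this
    have h2 : (Ideal.Quotient.mkₐ ℂ (Ideal.span {l})) P = (Ideal.Quotient.mkₐ ℂ (Ideal.span {l}))
        (aeval (fun j => C (s j / s i) * X i : Fin 2 → CoordRing 1) P) := by
      rw [← AlgHom.comp_apply, comp_aeval]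
      conv_lhs => rw [← aeval_X_left_apply P, ← AlgHom.comp_apply, comp_aeval]
      congr 2
      ext j
      exact hX j
    rw [hzero, map_zero] at h2
    exact h2
  obtain ⟨Q, hQ⟩ := hdvd
  -- The quotient is not known to be homogeneous, but its component of degree `e` serves equally
  -- well.
  refine ⟨homogeneousComponent e Q, homogeneousComponent_isHomogeneous e Q, ?_⟩
  rw [← homogeneousComponent_add_mul hl1 Q e, ← hQ, add_comm 1 e]
  exact (homogeneousComponent_eq_self hP).symm

/-! ### Parametrizations of a rational curve -/

/-- `F` is a tuple of binary forms of degree `e` which maps `ℂ²` to the affine cone over `W`, is not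
contained in a smaller algebraic set, and has the rational map `g` as a left inverse. -/
structure IsParam {n : ℕ} (W : Set (CP n)) (g : Fin 2 → CoordRing n) (e : ℕ)
    (F : Fin (n + 1) → CoordRing 1) : Prop where
  homog : ∀ i, (F i).IsHomogeneous e
  mem : ∀ x, evalForms F x ∈ affineCone W
  cross : ∀ x, x 0 * eval (evalForms F x).ofLp (g 1) = x 1 * eval (evalForms F x).ofLp (g 0)
  gen : ∃ x, ∃ j, eval (evalForms F x).ofLp (g j) ≠ 0
  dense : ∀ H : CoordRing n, (∀ x, eval (evalForms F x).ofLp H = 0) → H ∈ idealOf W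

/-- If `F` were constant, the constant vector `g (F x)` would be parallel to both basis vectors of
`ℂ²`, hence zero. -/
theorem degree_ne_zero_of_cross {n : ℕ} {g : Fin 2 → CoordRing n} {e : ℕ}
    {F : Fin (n + 1) → CoordRing 1} (homog : ∀ i, (F i).IsHomogeneous e)
    (cross : ∀ x, x 0 * eval (evalForms F x).ofLp (g 1) = x 1 * eval (evalForms F x).ofLp (g 0))
    (gen : ∃ x, ∃ j, eval (evalForms F x).ofLp (g j) ≠ 0) : e ≠ 0 := by
  rintro rfl
  obtain ⟨x, j, hj⟩ := gen
  have hc : ∀ y, evalForms F y = evalForms F x := by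
    intro y
    have h1 := evalForms_smul homog 0 y
    have h2 := evalForms_smul homog 0 x
    rw [pow_zero, one_smul, zero_smul] at h1 h2
    rw [← h1, h2]
  have h0 := cross !₂[(0 : ℂ), 1]
  have h1 := cross !₂[(1 : ℂ), 0]
  rw [hc] at h0 h1
  fin_cases j
  · exact hj (by simpa using h0.symm)
  · exact hj (by simpa using h1)

theorem exists_isParam {n : ℕ} {W : Set (CP n)} (hW : IsProjectiveCurve W)
    (hr : AreBirational (Set.univ : Set (CP 1)) W) :
    ∃ (b e : ℕ) (g : Fin 2 → CoordRing n) (F : Fin (n + 1) → CoordRing 1),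
      (∀ j, (g j).IsHomogeneous b) ∧ IsParam W g e F := by
  obtain ⟨a, b, f, g, hf, hg, h1, -, h3, h4, h5, h6⟩ := hr
  simp only [affineCone_univ, Set.mem_univ, forall_const] at h1 h3 h5
  have cross : ∀ x, x 0 * eval (evalForms f x).ofLp (g 1) =
      x 1 * eval (evalForms f x).ofLp (g 0) := by
    intro x
    obtain ⟨c, hc⟩ := h3 x
    have e0 := congrArg (fun v : AffSp 2 => v 0) hc
    have e1 := congrArg (fun v : AffSp 2 => v 1) hc
    simp only [evalForms, PiLp.smul_apply, smul_eq_mul] at e0 e1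
    simp only [evalForms]
    rw [e0, e1]
    ring
  have gen : ∃ x, ∃ j, eval (evalForms f x).ofLp (g j) ≠ 0 := by
    obtain ⟨x, -, -, hx⟩ := h5
    refine ⟨x, ?_⟩
    by_contra! hcon
    exact hx (by ext j; simpa [evalForms] using hcon j)
  have ha := degree_ne_zero_of_cross hf cross gen
  refine ⟨b, a, g, f, hg, hf, h1, cross, gen, fun H hH => ?_⟩
  obtain ⟨y, hy, -, hy2⟩ := h6
  obtain ⟨i, hi⟩ : ∃ i, evalForms f (evalForms g y) i ≠ 0 := by
    by_contra! hcon
    exact hy2 (by ext j; simpa using hcon j)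
  -- Where `f i` does not vanish at `g z`, the point `z` is itself in the image of `f` after
  -- rescaling `g z`, so `H z = 0`. Primality then removes the second factor, which is nonzero at
  -- `y`.
  have hprod : H * aeval g (f i) ∈ idealOf W := by
    intro z hz
    rw [map_mul, eval_aeval]
    by_cases hz2 : eval (fun j => eval z.ofLp (g j)) (f i) = 0
    · rw [hz2, mul_zero]
    obtain ⟨c, hc⟩ := h4 z hz
    have hc0 : c ≠ 0 := by
      rintro rfl
      rw [zero_smul] at hc
      exact hz2 (congrArg (fun v : AffSp (n + 1) => v i) hc)
    obtain ⟨μ, hμ⟩ := IsAlgClosed.exists_pow_nat_eq (c⁻¹) (Nat.pos_of_ne_zero ha)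
    have h7 := hH (μ • evalForms g z)
    rw [evalForms_smul hf, hμ, hc, inv_smul_smul₀ hc0] at h7
    rw [h7, zero_mul]
  refine (hW.isPrime.mem_or_mem hprod).resolve_right fun h => hi ?_
  have := h y hy
  rw [eval_aeval] at this
  exact this

theorem eval_evalForms {m n : ℕ} (F : Fin (n + 1) → CoordRing m) (x : AffSp (m + 1))
    (H : CoordRing n) : eval (evalForms F x).ofLp H = eval x.ofLp (aeval F H) := by
  rw [eval_aeval]; rfl

/-- A common zero of a parametrization can be divided out. -/
theorem IsParam.exists_pred {n : ℕ} {W : Set (CP n)} (hW : IsProjectiveCurve W)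
    {g : Fin 2 → CoordRing n} {b : ℕ} (hg : ∀ j, (g j).IsHomogeneous b) {e : ℕ}
    {F : Fin (n + 1) → CoordRing 1} (hF : IsParam W g e F) {s : AffSp 2} (hs : s ≠ 0)
    (h : evalForms F s = 0) : ∃ e' < e, ∃ F' : Fin (n + 1) → CoordRing 1, IsParam W g e' F' := by
  obtain ⟨e, rfl⟩ := Nat.exists_eq_succ_of_ne_zero
    (degree_ne_zero_of_cross hF.homog hF.cross hF.gen)
  have hs' : s.ofLp ≠ 0 := by simpa using hs
  choose Q hQ hFQ using fun i => exists_eq_linear_mul (hF.homog i) hs'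
    (congrArg (fun v : AffSp (n + 1) => v i) h)
  set l : CoordRing 1 := C (s.ofLp 1) * X 0 - C (s.ofLp 0) * X 1 with hl
  have hl0 : l ≠ 0 := by
    intro h0
    apply hs
    ext i
    fin_cases i
    · simpa [hl] using congrArg (eval ![0, -1]) h0
    · simpa [hl] using congrArg (eval ![1, 0]) h0
  have hev : ∀ x, evalForms F x = eval x.ofLp l • evalForms Q x := by
    intro x
    ext i
    simp [evalForms, hFQ]
  -- Identities for `Q` need only be checked off the line `l = 0`, where `Q` is a scalar multiple of
  -- `F`.
  have key : ∀ P : CoordRing 1, (∀ x : AffSp 2, eval x.ofLp l * eval x.ofLp P = 0) → P = 0 := by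
    intro P hP
    have : l * P = 0 := by
      apply MvPolynomial.funext
      intro x
      simpa using hP (WithLp.toLp 2 x)
    exact (mul_eq_zero.1 this).resolve_left hl0
  have key' : ∀ P : CoordRing 1, (∀ x : AffSp 2, eval x.ofLp l ≠ 0 → eval x.ofLp P = 0) →
      ∀ x : AffSp 2, eval x.ofLp P = 0 := by
    intro P hP x
    rw [key P fun y => ?_, map_zero]
    by_cases hy : eval y.ofLp l = 0
    · rw [hy, zero_mul]
    · rw [hP y hy, mul_zero]
  have cross : ∀ x, x 0 * eval (evalForms Q x).ofLp (g 1) =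
      x 1 * eval (evalForms Q x).ofLp (g 0) := by
    intro x
    have := key' (X 0 * aeval Q (g 1) - X 1 * aeval Q (g 0)) ?_ x
    · rw [eval_evalForms, eval_evalForms]
      simpa [sub_eq_zero] using this
    · intro y hy
      have h1 := hF.cross y
      rw [hev, WithLp.ofLp_smul, eval_smul_of_isHomogeneous (hg 0),
        eval_smul_of_isHomogeneous (hg 1)] at h1
      simp only [map_sub, map_mul, eval_X, ← eval_evalForms]
      apply mul_left_cancel₀ (pow_ne_zero b hy)
      linear_combination h1
  have gen : ∃ x, ∃ j, eval (evalForms Q x).ofLp (g j) ≠ 0 := by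
    obtain ⟨x, j, hj⟩ := hF.gen
    refine ⟨x, j, fun h0 => hj ?_⟩
    rw [hev, WithLp.ofLp_smul, eval_smul_of_isHomogeneous (hg j), h0, mul_zero]
  refine ⟨e, Nat.lt_succ_self e, Q, hQ, fun x => ?_, cross, gen, fun H hH => hF.dense H fun x => ?_⟩
  · rw [mem_affineCone_iff_forall_eval hW]
    intro H hH
    rw [eval_evalForms]
    refine key' _ (fun y hy => ?_) x
    rw [← eval_evalForms]
    have h1 : evalForms Q y ∈ affineCone W := by
      have := smul_mem_affineCone (hF.mem y) (eval y.ofLp l)⁻¹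
      rwa [hev, inv_smul_smul₀ hy] at this
    exact hH _ h1
  · have he := degree_ne_zero_of_cross hQ cross gen
    -- With `μ ^ e = l x` one has `Q (μ x) = F x`, so the image of `Q` contains that of `F`.
    obtain ⟨μ, hμ⟩ := IsAlgClosed.exists_pow_nat_eq (eval x.ofLp l) (Nat.pos_of_ne_zero he)
    have := hH (μ • x)
    rwa [evalForms_smul hQ, hμ, ← hev] at this

/-- A rational curve has a parametrization by binary forms without common zeros. -/
theorem exists_isParam_basepointFree {n : ℕ} {W : Set (CP n)} (hW : IsProjectiveCurve W)
    (hr : AreBirational (Set.univ : Set (CP 1)) W) :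
    ∃ (b e : ℕ) (g : Fin 2 → CoordRing n) (F : Fin (n + 1) → CoordRing 1),
      (∀ j, (g j).IsHomogeneous b) ∧ IsParam W g e F ∧ ∀ x : AffSp 2, x ≠ 0 → evalForms F x ≠ 0 := by
  classical
  obtain ⟨b, e, g, F, hg, hF⟩ := exists_isParam hW hr
  have hex : ∃ e, ∃ F : Fin (n + 1) → CoordRing 1, IsParam W g e F := ⟨e, F, hF⟩
  obtain ⟨F', hF'⟩ := Nat.find_spec hex
  refine ⟨b, _, g, F', hg, hF', fun x hx h0 => ?_⟩
  obtain ⟨e', he', hF''⟩ := hF'.exists_pred hW hg hx h0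
  exact Nat.find_min hex he' hF''

end

noncomputable section

open MvPolynomial

/-! ### Finiteness of base-point free parametrizations -/

/-- Each variable vanishes on the common zeros of the `F i`, so by the Nullstellensatz it lies in
the radical of the ideal they generate. -/
theorem exists_pow_idealOfVars_le {σ ι K : Type*} [Finite σ] [Field K] [IsAlgClosed K]
    (F : ι → MvPolynomial σ K) (h : ∀ x : σ → K, (∀ i, eval x (F i) = 0) → x = 0) :
    ∃ D, idealOfVars σ K ^ D ≤ Ideal.span (Set.range F) := by
  refine Ideal.exists_pow_le_of_le_radical_of_fg ?_ (idealOfVars_fg σ K)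
  rw [idealOfVars, Ideal.span_le]
  rintro _ ⟨j, rfl⟩
  rw [SetLike.mem_coe, ← vanishingIdeal_zeroLocus_eq_radical (K := K), mem_vanishingIdeal_iff]
  intro x hx
  rw [h x fun i => by simpa [aeval_eq_eval] using hx (F i) (Ideal.subset_span ⟨i, rfl⟩)]
  simp

/-- A polynomial ring is finite over the subring generated by forms of positive degree without
common zeros. -/
theorem finite_aeval_of_forall_eval_eq_zero {σ ι K : Type*} [Finite σ] [Finite ι] [Field K]
    [IsAlgClosed K] (F : ι → MvPolynomial σ K) {e : ℕ} (he : e ≠ 0)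
    (hF : ∀ i, (F i).IsHomogeneous e)
    (h : ∀ x : σ → K, (∀ i, eval x (F i) = 0) → x = 0) :
    (aeval F : MvPolynomial ι K →ₐ[K] MvPolynomial σ K).toRingHom.Finite := by
  classical
  have := Fintype.ofFinite ι
  obtain ⟨D, hD⟩ := exists_pow_idealOfVars_le F h
  let := (aeval F : MvPolynomial ι K →ₐ[K] MvPolynomial σ K).toRingHom.toAlgebra
  have hsmul : ∀ (a : MvPolynomial ι K) (q : MvPolynomial σ K), a • q = aeval F a * q :=
    fun _ _ => rfl
  have : IsScalarTower K (MvPolynomial ι K) (MvPolynomial σ K) :=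
    IsScalarTower.of_algebraMap_eq fun c => by
      change _ = aeval F _
      simp [algebraMap_eq]
  choose S hS using fun k => homogeneousSubmodule_fg (σ := σ) (R := K) k
  set T : Finset (MvPolynomial σ K) := (Finset.range (D + e)).biUnion S
  refine ⟨⟨T, ?_⟩⟩
  set M := Submodule.span (MvPolynomial ι K) (T : Set (MvPolynomial σ K)) with hM
  have hlow : ∀ k < D + e, ∀ P : MvPolynomial σ K, P.IsHomogeneous k → P ∈ M := by
    intro k hk P hP
    rw [← mem_homogeneousSubmodule, ← hS k] at hP
    have h1 : Submodule.span K (S k : Set (MvPolynomial σ K)) ≤ M.restrictScalars K := by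
      rw [Submodule.span_le]
      intro q hq
      exact Submodule.subset_span (by
        simp only [T, Finset.coe_biUnion, Set.mem_iUnion]
        exact ⟨k, by simpa using hk, hq⟩)
    exact h1 hP
  have hall : ∀ k, ∀ P : MvPolynomial σ K, P.IsHomogeneous k → P ∈ M := by
    intro k
    induction k using Nat.strong_induction_on with
    | _ k ih =>
    intro P hP
    rcases lt_or_ge k (D + e) with hk | hk
    · exact hlow k hk P hP
    -- A form of degree at least `D` is a combination of the `F i`; comparing components, its
    -- coefficients can be taken of degree lower by `e > 0`, where induction applies.
    have hPJ : P ∈ Ideal.span (Set.range F) := by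
      apply hD
      rw [mem_pow_idealOfVars_iff]
      intro d hd
      have := hP.degree_eq_sum_deg_support hd
      change D ≤ ∑ i ∈ d.support, d i
      omega
    obtain ⟨c, hc⟩ := (Ideal.mem_span_range_iff_exists_fun).1 hPJ
    obtain ⟨m, rfl⟩ := Nat.exists_eq_add_of_le (show e ≤ k by omega)
    have h2 : P = ∑ i, (X i : MvPolynomial ι K) • homogeneousComponent m (c i) := by
      rw [← homogeneousComponent_eq_self hP, ← hc, map_sum]
      refine Finset.sum_congr rfl fun i _ => ?_
      rw [mul_comm, homogeneousComponent_add_mul (hF i), hsmul, aeval_X]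
    rw [h2]
    exact sum_mem fun i _ => M.smul_mem _
      (ih m (by omega) _ (homogeneousComponent_isHomogeneous m _))
  rw [eq_top_iff]
  intro P _
  rw [← sum_homogeneousComponent P]
  exact sum_mem fun k _ => hall k _ (homogeneousComponent_isHomogeneous k P)

/-- The kernel of `aeval F` consists of polynomials vanishing on the image of `F`, hence on the cone
by density, so it lies in the maximal ideal of `y`. Lying over for the finite map `aeval F` gives a
maximal ideal of `ℂ[s, t]` above it, that is, a point `x`. -/
theorem IsParam.exists_evalForms_eq {n : ℕ} {W : Set (CP n)}
    {g : Fin 2 → CoordRing n} {e : ℕ} {F : Fin (n + 1) → CoordRing 1} (hF : IsParam W g e F)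
    (h0 : ∀ x : AffSp 2, x ≠ 0 → evalForms F x ≠ 0) {y : AffSp (n + 1)} (hy : y ∈ affineCone W) :
    ∃ x, evalForms F x = y := by
  have hfin := finite_aeval_of_forall_eval_eq_zero F
    (degree_ne_zero_of_cross hF.homog hF.cross hF.gen) hF.homog fun x hx => by
      by_contra hx0
      refine h0 (WithLp.toLp 2 x) (by simpa using hx0) ?_
      ext i
      exact hx i
  let := (aeval F : CoordRing n →ₐ[ℂ] CoordRing 1).toRingHom.toAlgebra
  have : Algebra.IsIntegral (CoordRing n) (CoordRing 1) := ⟨hfin.to_isIntegral⟩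
  have hmax : (vanishingIdeal ℂ {y.ofLp}).IsMaximal :=
    isMaximal_iff_eq_vanishingIdeal_singleton.2 ⟨_, rfl⟩
  obtain ⟨Q, hQ, hQc⟩ := Ideal.exists_ideal_over_maximal_of_isIntegral (S := CoordRing 1)
    (vanishingIdeal ℂ {y.ofLp}) (by
      intro H hH
      have hH' : aeval F H = 0 := hH
      rw [mem_vanishingIdeal_singleton_iff, aeval_eq_eval]
      exact hF.dense H (fun x => by rw [eval_evalForms, hH', map_zero]) y hy)
  obtain ⟨x, rfl⟩ := isMaximal_iff_eq_vanishingIdeal_singleton.1 hQ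
  refine ⟨WithLp.toLp 2 x, ?_⟩
  ext i
  have h1 : (X i - C (y.ofLp i) : CoordRing n) ∈ vanishingIdeal ℂ {y.ofLp} := by
    simp
  rw [← hQc, Ideal.mem_comap] at h1
  change aeval F (X i - C (y.ofLp i) : CoordRing n) ∈ _ at h1
  rw [mem_vanishingIdeal_singleton_iff] at h1
  simpa [sub_eq_zero, aeval_eq_eval, evalForms] using h1

end

noncomputable section

open MvPolynomial Filter Topology

/-! ### Local analysis at smooth points -/

/-- An analytic function of one complex variable which is injective on a punctured neighbourhood of
a point has nonzero derivative there. -/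
theorem deriv_ne_zero_of_injOn_punctured {φ : ℂ → ℂ} (hφ : AnalyticAt ℂ φ 0)
    (hinj : ∃ U ∈ 𝓝 (0 : ℂ), Set.InjOn φ (U \ {0})) : deriv φ 0 ≠ 0 := by
  obtain ⟨U, hU, hinj⟩ := hinj
  intro hd
  have hsub : AnalyticAt ℂ (fun z => φ z - φ 0) 0 := hφ.fun_sub analyticAt_const
  -- Infinite order means that `φ` is constant near `0`, contradicting injectivity at once.
  by_cases htop : analyticOrderAt (fun z => φ z - φ 0) 0 = ⊤
  · rw [analyticOrderAt_eq_top] at htop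
    have h1 : ∀ᶠ z in 𝓝[≠] (0 : ℂ), z ∈ U ∧ φ z - φ 0 = 0 ∧ z ≠ 0 :=
      (((eventually_mem_set.2 hU).and htop).filter_mono nhdsWithin_le_nhds).and
        eventually_mem_nhdsWithin |>.mono fun z hz => ⟨hz.1.1, hz.1.2, hz.2⟩
    obtain ⟨z, hzU, hz, hz0⟩ := h1.exists
    have h2 : ∀ᶠ w in 𝓝[≠] (0 : ℂ), w ≠ z :=
      (eventually_ne_nhds (Ne.symm hz0)).filter_mono nhdsWithin_le_nhds
    obtain ⟨w, ⟨hwU, hw, hw0⟩, hwz⟩ := (h1.and h2).exists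
    exact hwz (hinj ⟨hwU, hw0⟩ ⟨hzU, hz0⟩ (by rw [sub_eq_zero.1 hw, sub_eq_zero.1 hz]))
  obtain ⟨k, hk⟩ := ENat.ne_top_iff_exists.1 htop
  obtain ⟨g, hg, hg0, hgφ⟩ := hsub.analyticOrderAt_eq_natCast.1 hk.symm
  simp only [sub_zero, smul_eq_mul] at hgφ
  have hk0 : k ≠ 0 := by
    rintro rfl
    have := hgφ.self_of_nhds
    simp at this
    exact hg0 this.symm
  have hk1 : k ≠ 1 := by
    rintro rfl
    have h1 : HasDerivAt (fun z => z ^ 1 * g z) (g 0) 0 := by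
      simpa using (hasDerivAt_id' (0 : ℂ)).fun_mul hg.differentiableAt.hasDerivAt
    have h2 : HasDerivAt (fun z => φ z - φ 0) (g 0) 0 := h1.congr_of_eventuallyEq hgφ
    have h3 : HasDerivAt φ (g 0) 0 := by simpa using h2.add_const (φ 0)
    exact hg0 (h3.deriv ▸ hd)
  obtain ⟨r, hr⟩ := IsAlgClosed.exists_pow_nat_eq (g 0) (Nat.pos_of_ne_zero hk0)
  have hr0 : r ≠ 0 := by
    rintro rfl
    rw [zero_pow hk0] at hr
    exact hg0 hr.symm
  -- An analytic `k`-th root of `g`; the logarithm is harmless because `g z / g 0` is near `1`. Thus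
  -- `φ z - φ 0 = (z h z) ^ k` with `k ≥ 2`, and `z h z` is invertible near `0`, so the preimages of
  -- `w` and `ζ w` are two points with the same value of `φ`.
  set h : ℂ → ℂ := fun z => r * Complex.exp (Complex.log (g z / g 0) / k) with hh
  have hquot : AnalyticAt ℂ (fun z => g z / g 0) 0 := hg.fun_div analyticAt_const hg0
  have hh0 : AnalyticAt ℂ h 0 := by
    refine analyticAt_const.fun_mul (AnalyticAt.cexp' ?_)
    refine AnalyticAt.fun_div (hquot.clog ?_) analyticAt_const (by exact_mod_cast hk0)
    rw [div_self hg0]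
    exact Complex.one_mem_slitPlane
  have hpow : ∀ᶠ z in 𝓝 (0 : ℂ), h z ^ k = g z := by
    have h1 : ∀ᶠ z in 𝓝 (0 : ℂ), g z ≠ 0 := hg.continuousAt.eventually_ne hg0
    filter_upwards [h1] with z hz
    have hk0' : (k : ℂ) ≠ 0 := by exact_mod_cast hk0
    rw [hh, mul_pow, hr, ← Complex.exp_nat_mul, mul_div_cancel₀ _ hk0',
      Complex.exp_log (div_ne_zero hz hg0), mul_div_cancel₀ _ hg0]
  have hψ : HasStrictDerivAt (fun z => z * h z) (h 0) 0 := by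
    simpa using (hasStrictDerivAt_id (0 : ℂ)).fun_mul hh0.hasStrictDerivAt
  have hh00 : h 0 ≠ 0 := mul_ne_zero hr0 (Complex.exp_ne_zero _)
  have hmap := hψ.map_nhds_eq hh00
  simp only [zero_mul] at hmap
  set V : Set ℂ := {z | z ∈ U ∧ φ z - φ 0 = (z * h z) ^ k}
  have hV : V ∈ 𝓝 (0 : ℂ) := by
    filter_upwards [hU, hgφ, hpow] with z h1 h2 h3
    exact ⟨h1, by rw [h2, mul_pow, h3]⟩
  have hVim : (fun z => z * h z) '' V ∈ 𝓝 (0 : ℂ) := hmap ▸ image_mem_map hV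
  have hζ := Complex.isPrimitiveRoot_exp k hk0
  set ζ := Complex.exp (2 * Real.pi * Complex.I / k)
  have hVim' : ∀ᶠ w in 𝓝 (0 : ℂ), ζ * w ∈ (fun z => z * h z) '' V := by
    have : Tendsto (fun w => ζ * w) (𝓝 0) (𝓝 0) := by
      simpa using (continuous_const_mul ζ).tendsto 0
    exact this hVim
  obtain ⟨w, ⟨⟨z₁, hz₁, hw₁⟩, z₂, hz₂, hw₂⟩, hw0⟩ :=
    ((((eventually_mem_set.2 hVim).and hVim').filter_mono
      (nhdsWithin_le_nhds (s := {0}ᶜ))).and eventually_mem_nhdsWithin).exists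
  simp only at hw₁ hw₂
  have hw0' : w ≠ 0 := hw0
  have hz₁0 : z₁ ≠ 0 := by
    rintro rfl
    rw [zero_mul] at hw₁
    exact hw0' hw₁.symm
  have hz₂0 : z₂ ≠ 0 := by
    rintro rfl
    rw [zero_mul] at hw₂
    exact mul_ne_zero (Complex.exp_ne_zero _) hw0' hw₂.symm
  have heq : z₁ = z₂ := by
    refine hinj ⟨hz₁.1, hz₁0⟩ ⟨hz₂.1, hz₂0⟩ (sub_left_injective (b := φ 0) ?_)
    change φ z₁ - φ 0 = φ z₂ - φ 0
    rw [hz₁.2, hz₂.2, hw₁, hw₂, mul_pow, hζ.pow_eq_one, one_mul]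
  rw [heq, hw₂] at hw₁
  exact hζ.ne_one (by omega) (mul_right_cancel₀ hw0' (hw₁.trans (one_mul w).symm))

/-- A map with injective strict derivative is locally injective. -/
theorem HasStrictFDerivAt.exists_injOn_of_injective {E G : Type*} [NormedAddCommGroup E]
    [NormedSpace ℂ E] [FiniteDimensional ℂ E] [NormedAddCommGroup G] [NormedSpace ℂ G]
    {f : E → G} {f' : E →L[ℂ] G} {a : E} (hf : HasStrictFDerivAt f f' a)
    (hinj : Function.Injective f') : ∃ U ∈ 𝓝 a, Set.InjOn f U := by
  obtain ⟨K, hK, hA⟩ := (f' : E →ₗ[ℂ] G).injective_iff_antilipschitz.1 hinj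
  -- Half the expansion constant of `f'`: points with equal images then satisfy `‖x - y‖ ≤ ‖x - y‖ /
  -- 2`.
  have hc : 0 < K⁻¹ / 2 := half_pos (inv_pos.2 hK)
  obtain ⟨s, hs, hfs⟩ := hf.approximates_deriv_on_nhds (Or.inr hc)
  refine ⟨s, hs, fun x hx y hy hxy => ?_⟩
  have h1 := hfs x hx y hy
  rw [hxy, sub_self, zero_sub, norm_neg] at h1
  have h2 := hA.le_mul_dist x y
  rw [dist_eq_norm, dist_eq_norm] at h2
  have h3 : ‖f' x - f' y‖ ≤ (K : ℝ)⁻¹ / 2 * ‖x - y‖ := by rw [← map_sub]; simpa using h1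
  have hK' : (0 : ℝ) < K := hK
  have h4 : ‖x - y‖ ≤ K * ((K : ℝ)⁻¹ / 2 * ‖x - y‖) :=
    h2.trans (mul_le_mul_of_nonneg_left h3 hK'.le)
  have h5 : (K : ℝ) * ((K : ℝ)⁻¹ / 2 * ‖x - y‖) = ‖x - y‖ / 2 := by field_simp
  rw [h5] at h4
  have : ‖x - y‖ = 0 := by linarith [norm_nonneg (x - y)]
  exact sub_eq_zero.1 (norm_eq_zero.1 this)

/-- These are the coordinates of a basis `y, w` of `S`, extended to `V`. With `S` the tangent space
of the cone at `y`, `l₀` measures the radial direction and `l₁` a transverse one. -/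
theorem exists_coordinates_of_finrank_eq_two {K V : Type*} [Field K] [AddCommGroup V] [Module K V]
    [FiniteDimensional K V] {S : Submodule K V} (hS : Module.finrank K S = 2) {y : V} (hy : y ∈ S)
    (hy0 : y ≠ 0) :
    ∃ l₀ l₁ : V →ₗ[K] K, l₀ y = 1 ∧ l₁ y = 0 ∧ ∀ v ∈ S, l₀ v = 0 → l₁ v = 0 → v = 0 := by
  obtain ⟨w, hwS, hw⟩ : ∃ w ∈ S, w ∉ Submodule.span K {y} := by
    by_contra! hcon
    have := Submodule.finrank_mono (show S ≤ Submodule.span K {y} from hcon)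
    rw [hS, finrank_span_singleton hy0] at this
    omega
  have hli : LinearIndependent K ![y, w] := by
    rw [LinearIndependent.pair_iff' hy0]
    intro a ha
    exact hw (Submodule.mem_span_singleton.2 ⟨a, ha⟩)
  have hspan : Submodule.span K (Set.range ![y, w]) = S := by
    apply Submodule.eq_of_le_of_finrank_eq
    · rw [Submodule.span_le]
      rintro _ ⟨i, rfl⟩
      fin_cases i
      · exact hy
      · exact hwS
    · rw [finrank_span_eq_card hli, hS]
      rfl
  obtain ⟨L, hL⟩ := (Fintype.linearCombination K ![y, w]).exists_leftInverse_of_injective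
    (LinearMap.ker_eq_bot.2 (linearIndependent_iff_injective_fintypeLinearCombination.1 hli))
  have hL' : ∀ c, L (Fintype.linearCombination K ![y, w] c) = c := fun c => congrArg (· c) hL
  have hLy : L y = ![1, 0] := by
    have := hL' ![1, 0]
    simpa [Fintype.linearCombination_apply] using this
  refine ⟨LinearMap.proj 0 ∘ₗ L, LinearMap.proj 1 ∘ₗ L, by simp [hLy], by simp [hLy], ?_⟩
  intro v hv h0 h1
  rw [← hspan, ← Fintype.range_linearCombination] at hv
  obtain ⟨c, rfl⟩ := hv
  simp only [LinearMap.comp_apply, hL', LinearMap.proj_apply] at h0 h1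
  have : c = 0 := by ext i; fin_cases i <;> assumption
  rw [this, map_zero]

theorem hasStrictFDerivAt_eval {n : ℕ} (H : CoordRing n) (x : AffSp (n + 1)) :
    HasStrictFDerivAt (fun y : AffSp (n + 1) => eval y.ofLp H)
      (∑ i, gradAt H x i • (EuclideanSpace.proj i : AffSp (n + 1) →L[ℂ] ℂ)) x := by
  induction H using MvPolynomial.induction_on with
  | C a =>
    refine (hasStrictFDerivAt_const (𝕜 := ℂ) a x).congr_of_eventuallyEq (by simp) |>.congr_fderiv ?_
    ext v
    simp [gradAt]
  | add p q hp hq =>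
    simp only [map_add]
    refine (hp.fun_add hq).congr_fderiv ?_
    ext v
    simp [gradAt, add_mul, Finset.sum_add_distrib]
  | mul_X p j hp =>
    simp only [map_mul, eval_X]
    refine (hp.fun_mul
      (EuclideanSpace.proj j : AffSp (n + 1) →L[ℂ] ℂ).hasStrictFDerivAt).congr_fderiv ?_
    ext v
    simp [gradAt, Pi.single_apply, add_mul, Finset.sum_add_distrib, Finset.mul_sum, mul_assoc,
      apply_ite (eval x.ofLp)]

/-- The tangent space of the affine cone, cut out by the gradients of the polynomials in the ideal,
contains the lines of the cone. -/
theorem sum_gradAt_mul_eq_zero {n : ℕ} {W : Set (CP n)} {H : CoordRing n} (hH : H ∈ idealOf W)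
    {y : AffSp (n + 1)} (hy : y ∈ affineCone W) : ∑ i, gradAt H y i * y i = 0 := by
  have h1 : HasDerivAt (fun t : ℂ => t • y) y 1 := by
    simpa using (hasDerivAt_id (1 : ℂ)).smul_const y
  have h2 := (hasStrictFDerivAt_eval H ((1 : ℂ) • y)).hasFDerivAt.comp_hasDerivAt 1 h1
  have h3 : ((fun y : AffSp (n + 1) => eval y.ofLp H) ∘ fun t : ℂ => t • y) = fun _ => 0 := by
    ext t
    exact hH _ (smul_mem_affineCone hy t)
  rw [h3] at h2
  have h4 := h2.unique (hasDerivAt_const (1 : ℂ) (0 : ℂ))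
  simpa using h4

/-- Finitely many `H` in the ideal have gradients spanning the normal space, and `l₀`, `l₁` are
coordinates on its annihilator. Together they form a map with injective derivative at `p.rep`, and
all the `H` vanish on the cone. -/
theorem exists_coordinates_injOn_of_rep {n : ℕ} {W : Set (CP n)} (hW : IsSmoothCurve W) {p : CP n}
    (hp : p ∈ W) :
    ∃ l₀ l₁ : AffSp (n + 1) →L[ℂ] ℂ, l₀ p.rep = 1 ∧ l₁ p.rep = 0 ∧ ∃ U ∈ 𝓝 p.rep,
      ∀ x ∈ U, ∀ x' ∈ U, x ∈ affineCone W → x' ∈ affineCone W →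
        l₀ x = l₀ x' → l₁ x = l₁ x' → x = x' := by
  classical
  set y := p.rep with hy
  have hyW : y ∈ affineCone W := rep_mem_affineCone hp
  set D := Submodule.span ℂ ((fun F => gradAt F y) '' (idealOf W : Set (CoordRing n))) with hD
  have hrank : Module.finrank ℂ D + 1 = n := hW.2 p hp
  obtain ⟨t, ht, htD⟩ := (Submodule.fg_span_iff_fg_span_finset_subset _).1
    (IsNoetherian.noetherian D)
  have ht' : ∀ v ∈ t, ∃ H ∈ idealOf W, gradAt H y = v := fun v hv => ht hv
  choose! H hH hHg using ht'
  set S : Submodule ℂ (Fin (n + 1) → ℂ) :=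
    (D.map (dotProductEquiv ℂ (Fin (n + 1))).toLinearMap).dualCoannihilator with hSdef
  -- The gradients have rank `n - 1` in a space of dimension `n + 1`.
  have hS : Module.finrank ℂ S = 2 := by
    have h1 := Subspace.finrank_add_finrank_dualCoannihilator_eq
      (D.map (dotProductEquiv ℂ (Fin (n + 1))).toLinearMap)
    rw [LinearEquiv.finrank_map_eq, Module.finrank_fin_fun] at h1
    change _ + Module.finrank ℂ S = _ at h1
    omega
  have hmemS : ∀ v : Fin (n + 1) → ℂ, v ∈ S ↔ ∀ g ∈ t, ∑ i, g i * v i = 0 := by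
    intro v
    rw [hSdef, Submodule.mem_dualCoannihilator]
    constructor
    · intro h g hg
      exact h _ ⟨g, by rw [SetLike.mem_coe, hD, htD]; exact Submodule.subset_span hg, rfl⟩
    · rintro h _ ⟨g, hg, rfl⟩
      rw [SetLike.mem_coe, hD, htD] at hg
      change g ⬝ᵥ v = 0
      induction hg using Submodule.span_induction with
      | mem g hg => exact h g hg
      | zero => exact zero_dotProduct v
      | add a b _ _ ha hb => rw [add_dotProduct, ha, hb, add_zero]
      | smul c a _ ha => rw [smul_dotProduct, ha, smul_zero]
  have hyS : y.ofLp ∈ S := by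
    rw [hmemS]
    intro g hg
    have := sum_gradAt_mul_eq_zero (hH g hg) hyW
    rwa [hHg g hg] at this
  obtain ⟨l₀, l₁, h0, h1, hinj⟩ := exists_coordinates_of_finrank_eq_two hS hyS
    (by simpa using p.rep_nonzero)
  set E : AffSp (n + 1) →L[ℂ] (Fin (n + 1) → ℂ) :=
    (EuclideanSpace.equiv (Fin (n + 1)) ℂ).toContinuousLinearMap
  set L₀ : AffSp (n + 1) →L[ℂ] ℂ := l₀.toContinuousLinearMap ∘L E
  set L₁ : AffSp (n + 1) →L[ℂ] ℂ := l₁.toContinuousLinearMap ∘L E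
  refine ⟨L₀, L₁, h0, h1, ?_⟩
  have hder : HasStrictFDerivAt (fun x : AffSp (n + 1) =>
      ((fun g : t => eval x.ofLp (H g)), L₀ x, L₁ x))
      ((ContinuousLinearMap.pi fun g : t =>
        ∑ i, gradAt (H g) y i • (EuclideanSpace.proj i : AffSp (n + 1) →L[ℂ] ℂ)).prod
          (L₀.prod L₁)) y :=
    (hasStrictFDerivAt_pi.2 fun g : t => hasStrictFDerivAt_eval (H g) y).prodMk
      (L₀.hasStrictFDerivAt.prodMk L₁.hasStrictFDerivAt)
  obtain ⟨U, hU, hUinj⟩ := hder.exists_injOn_of_injective (by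
    rw [injective_iff_map_eq_zero]
    intro v hv
    simp only [ContinuousLinearMap.prod_apply, Prod.mk_eq_zero] at hv
    obtain ⟨hv1, hv2, hv3⟩ := hv
    have hvS : v.ofLp ∈ S := by
      rw [hmemS]
      intro g hg
      have := congrFun hv1 ⟨g, hg⟩
      simpa [hHg g hg] using this
    have := hinj _ hvS hv2 hv3
    simpa using this)
  refine ⟨U, hU, fun x hx x' hx' hxW hxW' e0 e1 => hUinj hx hx' ?_⟩
  simp only [Prod.mk.injEq]
  refine ⟨?_, e0, e1⟩
  ext g
  rw [hH g g.2 x hxW, hH g g.2 x' hxW']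

/-- Near a nonzero point, the affine cone over a smooth curve projects injectively to `ℂ²`. -/
theorem exists_coordinates_injOn {n : ℕ} {W : Set (CP n)} (hW : IsSmoothCurve W)
    {y : AffSp (n + 1)} (hy : y ∈ affineCone W) (hy0 : y ≠ 0) :
    ∃ l₀ l₁ : AffSp (n + 1) →L[ℂ] ℂ, l₀ y = 1 ∧ l₁ y = 0 ∧ ∃ U ∈ 𝓝 y,
      ∀ x ∈ U, ∀ x' ∈ U, x ∈ affineCone W → x' ∈ affineCone W →
        l₀ x = l₀ x' → l₁ x = l₁ x' → x = x' := by
  obtain ⟨l₀, l₁, h0, h1, U, hU, h⟩ :=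
    exists_coordinates_injOn_of_rep hW ((mem_affineCone_iff hy0).1 hy)
  obtain ⟨a, ha⟩ := Projectivization.exists_smul_eq_mk_rep ℂ y hy0
  have ha' : (a : ℂ) • y = (Projectivization.mk ℂ y hy0).rep := ha
  rw [← ha'] at h0 h1 hU
  refine ⟨(a : ℂ) • l₀, (a : ℂ) • l₁, by simpa using h0, by simpa using h1,
    (fun x => (a : ℂ) • x) ⁻¹' U, (continuous_const_smul (a : ℂ)).continuousAt.preimage_mem_nhds hU,
    fun x hx x' hx' hxW hxW' e0 e1 => ?_⟩
  refine smul_right_injective _ a.ne_zero (h _ hx _ hx' (smul_mem_affineCone hxW _)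
    (smul_mem_affineCone hxW' _) ?_ ?_)
  · simpa using e0
  · simpa using e1

end

noncomputable section

open MvPolynomial Filter Topology

/-! ### Immersivity and injectivity of the parametrization -/

theorem contDiff_evalForms {m n : ℕ} (F : Fin (n + 1) → CoordRing m) :
    ContDiff ℂ ω (evalForms F) := by
  rw [contDiff_euclidean]
  intro i
  change ContDiff ℂ ω fun x : AffSp (m + 1) => eval x.ofLp (F i)
  induction F i using MvPolynomial.induction_on with
  | C a => simpa using contDiff_const
  | add p q hp hq => simpa using hp.add hq
  | mul_X p j hp =>
    simp only [map_mul, eval_X]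
    exact hp.mul (EuclideanSpace.proj j : AffSp (m + 1) →L[ℂ] ℂ).contDiff

theorem hasDerivAt_evalForms_add_smul {m n : ℕ} (F : Fin (n + 1) → CoordRing m)
    (z w : AffSp (m + 1)) (t : ℂ) :
    HasDerivAt (fun t : ℂ => evalForms F (z + t • w)) (fderiv ℂ (evalForms F) (z + t • w) w) t := by
  have h1 : HasDerivAt (fun t : ℂ => z + t • w) w t := by
    simpa using ((hasDerivAt_id t).smul_const w).const_add z
  exact ((contDiff_evalForms F).differentiable (by simp) _).hasFDerivAt.comp_hasDerivAt t h1

/-- Euler's identity. -/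
theorem fderiv_evalForms_self {m n e : ℕ} {F : Fin (n + 1) → CoordRing m}
    (hF : ∀ i, (F i).IsHomogeneous e) (z : AffSp (m + 1)) :
    fderiv ℂ (evalForms F) z z = (e : ℂ) • evalForms F z := by
  have h1 := hasDerivAt_evalForms_add_smul F 0 z 1
  simp only [zero_add, evalForms_smul hF, one_smul] at h1
  refine h1.unique ?_
  simpa using (hasDerivAt_pow e (1 : ℂ)).smul_const (evalForms F z)

theorem exists_eq_smul_add_smul {z w : AffSp 2} (hzw : z 0 * w 1 - z 1 * w 0 ≠ 0) (v : AffSp 2) :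
    ∃ α β : ℂ, v = α • z + β • w := by
  refine ⟨(v 0 * w 1 - v 1 * w 0) / (z 0 * w 1 - z 1 * w 0),
    (z 0 * v 1 - z 1 * v 0) / (z 0 * w 1 - z 1 * w 0), ?_⟩
  ext i
  fin_cases i
  · simp
    rw [div_mul_eq_mul_div, div_mul_eq_mul_div, ← add_div, eq_div_iff hzw]
    ring
  · simp
    rw [div_mul_eq_mul_div, div_mul_eq_mul_div, ← add_div, eq_div_iff hzw]
    ring

section

variable {n : ℕ} {W : Set (CP n)} {b e : ℕ} {g : Fin 2 → CoordRing n}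
  {F : Fin (n + 1) → CoordRing 1}

/-- If the nonzero binary form `g j ∘ F` vanished for `t` near `0`, it would vanish for all `t`, and
by homogeneity at every vector off the line `ℂ w`, so it would be zero. -/
theorem IsParam.eventually_eval_ne_zero (hg : ∀ j, (g j).IsHomogeneous b) (hF : IsParam W g e F)
    {z w : AffSp 2} (hzw : z 0 * w 1 - z 1 * w 0 ≠ 0) :
    ∀ᶠ t in 𝓝[≠] (0 : ℂ), ∃ j, eval (evalForms F (z + t • w)).ofLp (g j) ≠ 0 := by
  obtain ⟨x, j, hj⟩ := hF.gen
  suffices h : ∀ᶠ t in 𝓝[≠] (0 : ℂ), eval (evalForms F (z + t • w)).ofLp (g j) ≠ 0 from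
    h.mono fun t ht => ⟨j, ht⟩
  have hd : Differentiable ℂ fun t : ℂ => eval (evalForms F (z + t • w)).ofLp (g j) := by
    have h1 : Differentiable ℂ fun y : AffSp (n + 1) => eval y.ofLp (g j) := fun y =>
      (hasStrictFDerivAt_eval (g j) y).hasFDerivAt.differentiableAt
    exact h1.comp fun t => (hasDerivAt_evalForms_add_smul F z w t).differentiableAt
  refine (hd.analyticAt 0).eventually_eq_zero_or_eventually_ne_zero.resolve_left fun h0 => ?_
  have hzero : ∀ t : ℂ, eval (evalForms F (z + t • w)).ofLp (g j) = 0 := fun t =>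
    AnalyticOnNhd.eqOn_zero_of_preconnected_of_eventuallyEq_zero (U := Set.univ)
      (fun t _ => hd.analyticAt t) isPreconnected_univ (Set.mem_univ 0) h0 (Set.mem_univ t)
  set l : CoordRing 1 := C (w.ofLp 1) * X 0 - C (w.ofLp 0) * X 1 with hl
  have hl0 : l ≠ 0 := by
    intro h
    apply hzw
    have := congrArg (eval z.ofLp) h
    simp [hl] at this
    linear_combination this
  have hprod : l * aeval F (g j) = 0 := by
    apply MvPolynomial.funext
    intro y
    rw [map_mul, map_zero, mul_eq_zero, or_iff_not_imp_left]
    intro hy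
    obtain ⟨α, β, hαβ⟩ := exists_eq_smul_add_smul hzw (WithLp.toLp 2 y)
    have hα : α ≠ 0 := by
      rintro rfl
      apply hy
      have h0 := congrArg (fun v : AffSp 2 => v 0) hαβ
      have h1 := congrArg (fun v : AffSp 2 => v 1) hαβ
      simp at h0 h1
      simp [hl, h0, h1]
      ring
    have h2 : WithLp.toLp 2 y = α • (z + (β / α) • w) := by
      rw [hαβ, smul_add, smul_smul, mul_div_cancel₀ _ hα]
    have h3 : eval (evalForms F (WithLp.toLp 2 y)).ofLp (g j) = 0 := by
      rw [h2, evalForms_smul hF.homog, WithLp.ofLp_smul, eval_smul_of_isHomogeneous (hg j), hzero,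
        mul_zero]
    rwa [eval_evalForms] at h3
  apply hj
  rw [eval_evalForms, (mul_eq_zero.1 hprod).resolve_left hl0, map_zero]

/-- Proportional values of `F` have proportional images under `g`; these are parallel to `x` and
`x'` respectively, and the second is nonzero. -/
theorem IsParam.cross_eq_of_evalForms_eq_smul (hg : ∀ j, (g j).IsHomogeneous b)
    (hF : IsParam W g e F) {x x' : AffSp 2} {c : ℂ} (hc : c ≠ 0)
    (h : evalForms F x = c • evalForms F x')
    (hx' : ∃ j, eval (evalForms F x').ofLp (g j) ≠ 0) : x 0 * x' 1 = x 1 * x' 0 := by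
  have h1 := hF.cross x
  have h2 := hF.cross x'
  rw [h, WithLp.ofLp_smul, eval_smul_of_isHomogeneous (hg 0),
    eval_smul_of_isHomogeneous (hg 1)] at h1
  have h3 : x 0 * eval (evalForms F x').ofLp (g 1) = x 1 * eval (evalForms F x').ofLp (g 0) := by
    apply mul_left_cancel₀ (pow_ne_zero b hc)
    linear_combination h1
  obtain ⟨j, hj⟩ := hx'
  apply mul_right_cancel₀ hj
  fin_cases j
  · simp only [Fin.zero_eta, Fin.isValue]
    linear_combination x' 0 * h3 - x 0 * h2
  · simp only [Fin.mk_one, Fin.isValue]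
    linear_combination x' 1 * h3 - x 1 * h2

/-- The inhomogeneous local coordinate `l₁ / l₀` along the branch `t ↦ F (z + t w)`. -/
def branchCoord (F : Fin (n + 1) → CoordRing 1) (l₀ l₁ : AffSp (n + 1) →L[ℂ] ℂ) (z w : AffSp 2)
    (t : ℂ) : ℂ :=
  l₁ (evalForms F (z + t • w)) / l₀ (evalForms F (z + t • w))

theorem hasStrictDerivAt_branchCoord {l₀ l₁ : AffSp (n + 1) →L[ℂ] ℂ} {z : AffSp 2}
    (h0 : l₀ (evalForms F z) = 1) (h1 : l₁ (evalForms F z) = 0) (w : AffSp 2) :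
    AnalyticAt ℂ (branchCoord F l₀ l₁ z w) 0 ∧
      HasStrictDerivAt (branchCoord F l₀ l₁ z w) (l₁ (fderiv ℂ (evalForms F) z w)) 0 := by
  have hd := hasDerivAt_evalForms_add_smul F z w
  have hdiff : ∀ l : AffSp (n + 1) →L[ℂ] ℂ,
      Differentiable ℂ fun t : ℂ => l (evalForms F (z + t • w)) := fun l t =>
    (l.hasFDerivAt.comp_hasDerivAt t (hd t)).differentiableAt
  have han : AnalyticAt ℂ (branchCoord F l₀ l₁ z w) 0 :=
    ((hdiff l₁).analyticAt 0).fun_div ((hdiff l₀).analyticAt 0) (by simp [h0])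
  refine ⟨han, ?_⟩
  have h2 : HasDerivAt (branchCoord F l₀ l₁ z w) (l₁ (fderiv ℂ (evalForms F) z w)) 0 := by
    have h3 := l₁.hasFDerivAt.comp_hasDerivAt 0 (hd 0)
    have h4 := l₀.hasFDerivAt.comp_hasDerivAt 0 (hd 0)
    have h5 := h3.div h4 (by simp [h0])
    exact h5.congr_deriv (by simp [h0, h1])
  exact h2.deriv ▸ han.hasStrictDerivAt

/-- Two points on branches through the same point whose local coordinates agree are
proportional. -/
theorem IsParam.eventually_cross_eq (hg : ∀ j, (g j).IsHomogeneous b) (hF : IsParam W g e F)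
    {l₀ l₁ : AffSp (n + 1) →L[ℂ] ℂ} {y : AffSp (n + 1)} (h0 : l₀ y = 1)
    {U : Set (AffSp (n + 1))} (hU : U ∈ 𝓝 y)
    (hinj : ∀ x ∈ U, ∀ x' ∈ U, x ∈ affineCone W → x' ∈ affineCone W →
      l₀ x = l₀ x' → l₁ x = l₁ x' → x = x')
    {z w z' w' : AffSp 2} (hz : evalForms F z = y) (hz' : evalForms F z' = y)
    (hzw' : z' 0 * w' 1 - z' 1 * w' 0 ≠ 0) :
    ∃ V ∈ 𝓝 (0 : ℂ), ∀ t ∈ V, ∀ t' ∈ V, t' ≠ 0 →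
      branchCoord F l₀ l₁ z w t = branchCoord F l₀ l₁ z' w' t' →
      (z + t • w) 0 * (z' + t' • w') 1 = (z + t • w) 1 * (z' + t' • w') 0 := by
  have hnear : ∀ z w : AffSp 2, evalForms F z = y → ∀ᶠ t in 𝓝 (0 : ℂ),
      l₀ (evalForms F (z + t • w)) ≠ 0 ∧
      (l₀ (evalForms F (z + t • w)))⁻¹ • evalForms F (z + t • w) ∈ U := by
    intro z w hz
    have hc : ContinuousAt (fun t : ℂ => evalForms F (z + t • w)) 0 :=
      (hasDerivAt_evalForms_add_smul F z w 0).continuousAt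
    have hc0 : ContinuousAt (fun t : ℂ => l₀ (evalForms F (z + t • w))) 0 :=
      l₀.continuous.continuousAt.comp hc
    have hne : l₀ (evalForms F (z + (0 : ℂ) • w)) ≠ 0 := by simp [hz, h0]
    refine (hc0.eventually_ne hne).and (((hc0.inv₀ hne).smul hc).eventually_mem ?_)
    simpa [hz, h0] using hU
  have hgen := hF.eventually_eval_ne_zero hg hzw'
  rw [eventually_nhdsWithin_iff] at hgen
  have hV := ((hnear z w hz).and (hnear z' w' hz')).and hgen
  refine ⟨_, hV, fun t ht t' ht' ht0 heq => ?_⟩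
  obtain ⟨⟨⟨a1, a2⟩, -⟩, -⟩ := ht
  obtain ⟨⟨-, b1, b2⟩, b3⟩ := ht'
  -- Dividing by `l₀` moves both points into the slice `l₀ = 1`, where `l₁` alone determines a point
  -- of the cone.
  have h2 := hinj _ a2 _ b2 (smul_mem_affineCone (hF.mem _) _) (smul_mem_affineCone (hF.mem _) _)
    (by simp [a1, b1]) (by simpa [branchCoord, div_eq_inv_mul] using heq)
  refine hF.cross_eq_of_evalForms_eq_smul hg (mul_ne_zero a1 (inv_ne_zero b1)) ?_ (b3 ht0)
  rw [mul_smul, ← h2, smul_inv_smul₀ a1]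

/-- A branch compared with itself: equal coordinates at nonzero `t`, `t'` make `z + t w` and `z + t'
w` parallel, so `t = t'`. The coordinate is thus injective on a punctured neighbourhood of `0`. -/
theorem IsParam.coord_fderiv_ne_zero (hg : ∀ j, (g j).IsHomogeneous b) (hF : IsParam W g e F)
    {l₀ l₁ : AffSp (n + 1) →L[ℂ] ℂ} {y : AffSp (n + 1)} (h0 : l₀ y = 1) (h1 : l₁ y = 0)
    {U : Set (AffSp (n + 1))} (hU : U ∈ 𝓝 y)
    (hinj : ∀ x ∈ U, ∀ x' ∈ U, x ∈ affineCone W → x' ∈ affineCone W →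
      l₀ x = l₀ x' → l₁ x = l₁ x' → x = x')
    {z w : AffSp 2} (hz : evalForms F z = y) (hzw : z 0 * w 1 - z 1 * w 0 ≠ 0) :
    l₁ (fderiv ℂ (evalForms F) z w) ≠ 0 := by
  obtain ⟨han, hd⟩ := hasStrictDerivAt_branchCoord (hz.symm ▸ h0) (hz.symm ▸ h1) w
  rw [← hd.hasDerivAt.deriv]
  refine deriv_ne_zero_of_injOn_punctured han ?_
  obtain ⟨V, hV, hVinj⟩ := hF.eventually_cross_eq hg h0 hU hinj (w := w) hz hz hzw
  refine ⟨V, hV, fun t ht t' ht' heq => ?_⟩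
  have h2 := hVinj t ht.1 t' ht'.1 ht'.2 heq
  simp at h2
  have h3 : (t' - t) * (z 0 * w 1 - z 1 * w 0) = 0 := by linear_combination h2
  exact (sub_eq_zero.1 ((mul_eq_zero.1 h3).resolve_right hzw)).symm

theorem exists_cross_ne_zero {z : AffSp 2} (hz : z ≠ 0) : ∃ w : AffSp 2,
    z 0 * w 1 - z 1 * w 0 ≠ 0 := by
  by_contra! hcon
  apply hz
  ext i
  fin_cases i
  · simpa using hcon !₂[0, 1]
  · simpa using hcon !₂[1, 0]

/-- A base-point free parametrization of a smooth curve is an immersion of cones. -/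
theorem IsParam.fderiv_injective (hW : IsSmoothCurve W) (hg : ∀ j, (g j).IsHomogeneous b)
    (hF : IsParam W g e F) {z : AffSp 2} (hz : z ≠ 0) (hFz : evalForms F z ≠ 0) :
    Function.Injective (fderiv ℂ (evalForms F) z) := by
  obtain ⟨l₀, l₁, h0, h1, U, hU, hinj⟩ := exists_coordinates_injOn hW (hF.mem z) hFz
  obtain ⟨w, hzw⟩ := exists_cross_ne_zero hz
  have hw := hF.coord_fderiv_ne_zero hg h0 h1 hU hinj rfl hzw
  have he := degree_ne_zero_of_cross hF.homog hF.cross hF.gen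
  rw [injective_iff_map_eq_zero]
  intro v hv
  obtain ⟨α, β, rfl⟩ := exists_eq_smul_add_smul hzw v
  rw [map_add, map_smul, map_smul, fderiv_evalForms_self hF.homog] at hv
  -- By Euler, the derivative in the direction `z` is `e F(z)`, which `l₁` kills; so `l₁` isolates
  -- `β`, and `l₀` then isolates `α`.
  have e1 := congrArg l₁ hv
  simp [h1, hw] at e1
  have e0 := congrArg l₀ hv
  simp [h0, e1, he] at e0
  rw [e0, e1, zero_smul, zero_smul, add_zero]

/-- If `z`, `z'` were independent, the branches `z + t z'` and `z' + t' z` would both have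
coordinates covering a neighbourhood of `0`. A common nonzero value at small `t`, `t'` makes these
vectors parallel, so `t t' = 1`, which is impossible inside the unit disc. -/
theorem IsParam.cross_eq_of_evalForms_eq (hW : IsSmoothCurve W) (hg : ∀ j, (g j).IsHomogeneous b)
    (hF : IsParam W g e F) {z z' : AffSp 2} (h : evalForms F z = evalForms F z')
    (hFz : evalForms F z ≠ 0) : z 0 * z' 1 - z 1 * z' 0 = 0 := by
  by_contra hzz
  obtain ⟨l₀, l₁, h0, h1, U, hU, hinj⟩ := exists_coordinates_injOn hW (hF.mem z) hFz
  have hzz' : z' 0 * z 1 - z' 1 * z 0 ≠ 0 := fun h => hzz (by linear_combination -h)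
  have hd := hF.coord_fderiv_ne_zero hg h0 h1 hU hinj rfl hzz
  obtain ⟨-, hs⟩ := hasStrictDerivAt_branchCoord h0 h1 z'
  have hd' := hF.coord_fderiv_ne_zero hg h0 h1 hU hinj h.symm hzz'
  obtain ⟨-, hs'⟩ := hasStrictDerivAt_branchCoord (h ▸ h0) (h ▸ h1) z
  obtain ⟨V, hV, hVc⟩ := hF.eventually_cross_eq hg h0 hU hinj (w := z') rfl h.symm hzz'
  have hsmall : Metric.ball (0 : ℂ) 1 ∈ 𝓝 (0 : ℂ) := Metric.ball_mem_nhds 0 one_pos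
  have m1 := hs.map_nhds_eq hd
  have m2 := hs'.map_nhds_eq hd'
  have v1 : branchCoord F l₀ l₁ z z' 0 = 0 := by simp [branchCoord, h1]
  have v2 : branchCoord F l₀ l₁ z' z 0 = 0 := by simp [branchCoord, ← h, h1]
  have i1 := image_mem_map (m := branchCoord F l₀ l₁ z z') (inter_mem hV hsmall)
  have i2 := image_mem_map (m := branchCoord F l₀ l₁ z' z) (inter_mem hV hsmall)
  rw [m1, v1] at i1
  rw [m2, v2] at i2
  obtain ⟨c, ⟨⟨t, ht, htc⟩, t', ht', htc'⟩, hc0⟩ :=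
    ((((eventually_mem_set.2 i1).and i2).filter_mono
      (nhdsWithin_le_nhds (s := {0}ᶜ))).and eventually_mem_nhdsWithin).exists
  have ht0 : t' ≠ 0 := by
    rintro rfl
    exact hc0 (htc'.symm.trans v2)
  have h2 := hVc t ht.1 t' ht'.1 ht0 (htc.trans htc'.symm)
  simp at h2
  have h3 : (1 - t * t') * (z 0 * z' 1 - z 1 * z' 0) = 0 := by linear_combination h2
  have h4 : t * t' = 1 := (sub_eq_zero.1 ((mul_eq_zero.1 h3).resolve_right hzz)).symm
  have h5 : ‖t‖ * ‖t'‖ = 1 := by rw [← norm_mul, h4, norm_one]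
  have h6 : ‖t‖ < 1 := by simpa using ht.2
  have h7 : ‖t'‖ < 1 := by simpa using ht'.2
  nlinarith [norm_nonneg t, norm_nonneg t']

/-- A base-point free parametrization of a smooth curve is injective on `ℂP¹`. -/
theorem IsParam.exists_smul_eq (hW : IsSmoothCurve W) (hg : ∀ j, (g j).IsHomogeneous b)
    (hF : IsParam W g e F) (hbf : ∀ x : AffSp 2, x ≠ 0 → evalForms F x ≠ 0) {x x' : AffSp 2}
    (hx : x ≠ 0) {c : ℂ} (hc : c ≠ 0) (h : evalForms F x' = c • evalForms F x) :
    ∃ a : ℂ, x' = a • x ∧ a ^ e = c := by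
  have he := degree_ne_zero_of_cross hF.homog hF.cross hF.gen
  obtain ⟨μ, hμ⟩ := IsAlgClosed.exists_pow_nat_eq c (Nat.pos_of_ne_zero he)
  have hμ0 : μ ≠ 0 := by
    rintro rfl
    rw [zero_pow he] at hμ
    exact hc hμ.symm
  have h1 : evalForms F (μ • x) = evalForms F x' := by rw [evalForms_smul hF.homog, hμ, h]
  have h2 := hF.cross_eq_of_evalForms_eq hW hg h1 (hbf _ (smul_ne_zero hμ0 hx))
  simp only [PiLp.smul_apply, smul_eq_mul] at h2
  have h3 : x 0 * x' 1 - x 1 * x' 0 = 0 := by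
    apply mul_left_cancel₀ hμ0
    linear_combination h2
  obtain ⟨a, rfl⟩ : ∃ a : ℂ, x' = a • x := by
    obtain ⟨i, hi⟩ : ∃ i, x i ≠ 0 := by
      by_contra! hcon
      exact hx (by ext i; simpa using hcon i)
    refine ⟨x' i / x i, ?_⟩
    ext k
    rw [PiLp.smul_apply, smul_eq_mul, div_mul_eq_mul_div, eq_div_iff hi]
    fin_cases i <;> fin_cases k <;> simp <;>
      first | ring1 | linear_combination h3 | linear_combination -h3
  refine ⟨a, rfl, ?_⟩
  rw [evalForms_smul hF.homog] at h
  exact smul_left_injective ℂ (hbf x hx) h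

end

end

noncomputable section

open MvPolynomial

/-! ### The degree of a parametrized curve -/

theorem MvPolynomial.exists_eval_ne_zero {σ K : Type*} [Field K] [Infinite K]
    {P : MvPolynomial σ K} (hP : P ≠ 0) : ∃ x, eval x P ≠ 0 := by
  by_contra! h
  exact hP (MvPolynomial.funext fun x => by rw [h x, map_zero])

/-- On the line `u + s v`, `G` becomes a polynomial in `s` that is nonzero at `s = 0`. -/
theorem MvPolynomial.finite_eval_pencil_eq_zero {σ K : Type*} [Field K] {G : MvPolynomial σ K}
    {u : σ → K} (hu : eval u G ≠ 0) (v : σ → K) : {s : K | eval (u + s • v) G = 0}.Finite := by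
  set Q : Polynomial K := aeval (fun i => Polynomial.C (u i) + Polynomial.X * Polynomial.C (v i)) G
    with hQ
  have hQs : ∀ s, Q.eval s = eval (u + s • v) G := by
    intro s
    rw [hQ]
    clear hQ Q hu
    induction G using MvPolynomial.induction_on with
    | C a => simp
    | add p q hp hq => rw [map_add, Polynomial.eval_add, hp, hq, map_add]
    | mul_X p j hp =>
      rw [map_mul, Polynomial.eval_mul, hp, map_mul]
      simp [mul_comm s]
  have hQ0 : Q ≠ 0 := by
    intro h
    have := hQs 0
    rw [h, zero_smul, add_zero, Polynomial.eval_zero] at this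
    exact hu this.symm
  refine (Polynomial.finite_setOfPred_isRoot hQ0).subset fun s hs => ?_
  exact (hQs s).trans hs

/-- In a pencil of polynomials of degree `e` without base points, all but finitely many members
have `e` distinct roots. -/
theorem Polynomial.exists_finite_card_roots_pencil {U V : Polynomial ℂ} {e : ℕ} (he : e ≠ 0)
    (hU : U.natDegree = e) (hV : V.natDegree ≤ e) (hUV : ∀ t, U.eval t = 0 → V.eval t ≠ 0) :
    ∃ B : Set ℂ, B.Finite ∧ ∀ s ∉ B, (U + Polynomial.C s * V).coeff e ≠ 0 ∧
      (U + Polynomial.C s * V).roots.toFinset.card = e := by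
  -- A multiple root of `U + s V` is a root of this Wronskian, by elimination of `s`. The Wronskian
  -- is nonzero: otherwise `U`, being coprime to `V`, would divide its own derivative.
  set R := Polynomial.derivative U * V - U * Polynomial.derivative V with hR
  have hR0 : R ≠ 0 := by
    intro h
    have hcop : IsCoprime U V := by
      rw [Polynomial.isCoprime_iff_aeval_ne_zero_of_isAlgClosed ℂ ℂ]
      intro t
      simp only [Polynomial.coe_aeval_eq_eval]
      by_cases ht : U.eval t = 0
      · exact Or.inr (hUV t ht)
      · exact Or.inl ht
    have hdvd : U ∣ Polynomial.derivative U :=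
      hcop.dvd_of_dvd_mul_right ⟨Polynomial.derivative V, sub_eq_zero.1 h⟩
    have h0 := Polynomial.eq_zero_of_dvd_of_natDegree_lt hdvd
      (Polynomial.natDegree_derivative_lt (by omega))
    exact he (hU ▸ Polynomial.derivative_eq_zero.1 h0)
  have hlead : U.coeff e ≠ 0 := by
    rw [← hU, Polynomial.coeff_natDegree, Polynomial.leadingCoeff_ne_zero]
    rintro rfl
    exact he (by simpa using hU.symm)
  -- The excluded `s` are the one where the degree drops and those giving a root at a zero of the
  -- Wronskian. A zero denominator merely excludes `s = 0` as well.
  refine ⟨{-U.coeff e / V.coeff e} ∪ (fun t => -U.eval t / V.eval t) '' (R.roots.toFinset : Set ℂ),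
    (Set.finite_singleton _).union ((Finset.finite_toSet _).image _), fun s hs => ?_⟩
  simp only [Set.mem_union, Set.mem_singleton_iff, Set.mem_image, Finset.mem_coe,
    Multiset.mem_toFinset, not_or, not_exists, not_and] at hs
  obtain ⟨hs1, hs2⟩ := hs
  set P := U + Polynomial.C s * V with hP
  have hcoeff : P.coeff e ≠ 0 := by
    intro h
    rw [hP, Polynomial.coeff_add, Polynomial.coeff_C_mul] at h
    have hV0 : V.coeff e ≠ 0 := by
      intro h0
      rw [h0, mul_zero, add_zero] at h
      exact hlead h
    apply hs1
    rw [eq_div_iff hV0]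
    linear_combination h
  have hdeg : P.natDegree = e := by
    refine le_antisymm ?_ (Polynomial.le_natDegree_of_ne_zero hcoeff)
    exact (Polynomial.natDegree_add_le _ _).trans
      (max_le hU.le ((Polynomial.natDegree_C_mul_le _ _).trans hV))
  have hP0 : P ≠ 0 := by
    rintro h
    rw [h, Polynomial.coeff_zero] at hcoeff
    exact hcoeff rfl
  refine ⟨hcoeff, ?_⟩
  have hnodup : P.roots.Nodup := by
    rw [Multiset.nodup_iff_count_le_one]
    intro t
    rw [Polynomial.count_roots]
    by_contra! h
    obtain ⟨h1, h2⟩ := (Polynomial.one_lt_rootMultiplicity_iff_isRoot hP0).1 h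
    simp only [hP, Polynomial.IsRoot.def, Polynomial.derivative_add, Polynomial.eval_add,
      Polynomial.derivative_C_mul, Polynomial.eval_mul, Polynomial.eval_C] at h1 h2
    have hVt : V.eval t ≠ 0 := by
      intro h0
      rw [h0, mul_zero, add_zero] at h1
      exact hUV t h1 h0
    refine hs2 t ?_ ?_
    · rw [Polynomial.mem_roots hR0, Polynomial.IsRoot.def, hR]
      simp only [Polynomial.eval_sub, Polynomial.eval_mul]
      linear_combination V.eval t * h2 - (Polynomial.derivative V).eval t * h1
    · rw [div_eq_iff hVt]
      linear_combination -h1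
  rw [Multiset.toFinset_card_of_nodup hnodup, ← hdeg]
  exact ((IsAlgClosed.splits P).natDegree_eq_card_roots).symm

/-- The dehomogenization `P(1, t)` of a binary form. -/
def dehomogenize : CoordRing 1 →ₐ[ℂ] Polynomial ℂ :=
  aeval ![1, Polynomial.X]

theorem eval_dehomogenize (P : CoordRing 1) (t : ℂ) :
    (dehomogenize P).eval t = eval ![1, t] P := by
  rw [dehomogenize]
  induction P using MvPolynomial.induction_on with
  | C a => simp
  | add p q hp hq => simp [hp, hq]
  | mul_X p j hp =>
    rw [map_mul, Polynomial.eval_mul, hp, map_mul]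
    fin_cases j <;> simp

theorem dehomogenize_eq_sum (P : CoordRing 1) :
    dehomogenize P = ∑ d ∈ P.support, Polynomial.C (coeff d P) * Polynomial.X ^ d 1 := by
  rw [dehomogenize, aeval_def, eval₂_eq']
  simp

theorem add_eq_of_mem_support {P : CoordRing 1} {e : ℕ} (hP : P.IsHomogeneous e)
    {d : Fin 2 →₀ ℕ} (hd : d ∈ P.support) : d 0 + d 1 = e := by
  have h : d.degree = e := (hP.degree_eq_sum_deg_support hd).symm
  rw [Finsupp.degree_eq_sum] at h
  exact (Fin.sum_univ_two fun i => d i).symm.trans h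

theorem natDegree_dehomogenize_le {P : CoordRing 1} {e : ℕ} (hP : P.IsHomogeneous e) :
    (dehomogenize P).natDegree ≤ e := by
  rw [dehomogenize_eq_sum]
  refine Polynomial.natDegree_sum_le_of_forall_le _ _ fun d hd => ?_
  refine (Polynomial.natDegree_C_mul_X_pow_le _ _).trans ?_
  have := add_eq_of_mem_support hP hd
  omega

/-- The coefficient in degree `e` detects a zero at `(0, 1)`, the one point of `ℂP¹` missed by `t ↦
(1, t)`. -/
theorem coeff_dehomogenize {P : CoordRing 1} {e : ℕ} (hP : P.IsHomogeneous e) :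
    (dehomogenize P).coeff e = eval ![0, 1] P := by
  rw [dehomogenize_eq_sum, Polynomial.finsetSum_coeff, eval_eq']
  refine Finset.sum_congr rfl fun d hd => ?_
  have := add_eq_of_mem_support hP hd
  simp only [Polynomial.coeff_C_mul, Polynomial.coeff_X_pow, Fin.prod_univ_two]
  by_cases h : e = d 1
  · have h0 : d 0 = 0 := by omega
    simp [h, h0]
  · have h0 : d 0 ≠ 0 := by omega
    simp [h, h0]

/-- The pullback of a linear form along a tuple of binary forms. -/
def pullbackLinear {n : ℕ} (F : Fin (n + 1) → CoordRing 1) (a : Fin (n + 1) → ℂ) : CoordRing 1 :=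
  ∑ i, C (a i) * F i

theorem eval_pullbackLinear {n : ℕ} (F : Fin (n + 1) → CoordRing 1) (a : Fin (n + 1) → ℂ)
    (x : AffSp 2) : eval x.ofLp (pullbackLinear F a) = ∑ i, a i * evalForms F x i := by
  simp [pullbackLinear, evalForms]

theorem isHomogeneous_pullbackLinear {n e : ℕ} {F : Fin (n + 1) → CoordRing 1}
    (hF : ∀ i, (F i).IsHomogeneous e) (a : Fin (n + 1) → ℂ) :
    (pullbackLinear F a).IsHomogeneous e :=
  IsHomogeneous.sum _ _ _ fun i _ => (hF i).C_mul _

theorem linear_ne_zero {n : ℕ} {v : AffSp (n + 1)} (hv : v ≠ 0) :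
    (∑ i, C (v i) * X i : CoordRing n) ≠ 0 := by
  intro h
  apply hv
  ext i
  simpa [Pi.single_apply] using congrArg (eval (Pi.single i 1)) h

/-! ### Hyperplane sections of the parametrized curve. -/

section

variable {n : ℕ} {W : Set (CP n)} {b e : ℕ} {g : Fin 2 → CoordRing n}
  {F : Fin (n + 1) → CoordRing 1}

/-- `F` induces a bijection from `ℂP¹` to `W`, under which the section corresponds to the zeros of
the pulled-back form. By `ha` none of these is the point `(0, 1)`, so all are visible as roots `t`.
-/
theorem IsParam.encard_hyperplane_section (hW : IsSmoothCurve W)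
    (hg : ∀ j, (g j).IsHomogeneous b)
    (hF : IsParam W g e F) (hbf : ∀ x : AffSp 2, x ≠ 0 → evalForms F x ≠ 0)
    {a : Fin (n + 1) → ℂ} (ha : (dehomogenize (pullbackLinear F a)).coeff e ≠ 0) :
    {p : CP n | p ∈ W ∧ ∑ i, a i * p.rep.ofLp i = 0}.encard =
      (dehomogenize (pullbackLinear F a)).roots.toFinset.card := by
  set P := dehomogenize (pullbackLinear F a) with hP
  have hP0 : P ≠ 0 := by
    rintro h
    rw [h, Polynomial.coeff_zero] at ha
    exact ha rfl
  have hne : ∀ t : ℂ, (!₂[1, t] : AffSp 2) ≠ 0 := by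
    intro t h
    simpa using congrArg (fun v : AffSp 2 => v 0) h
  have hroot : ∀ t : ℂ, t ∈ P.roots.toFinset ↔ ∑ i, a i * evalForms F !₂[1, t] i = 0 := by
    intro t
    rw [Multiset.mem_toFinset, Polynomial.mem_roots hP0, Polynomial.IsRoot.def, hP,
      eval_dehomogenize, ← eval_pullbackLinear]
  set m : ℂ → CP n := fun t => Projectivization.mk ℂ (evalForms F !₂[1, t]) (hbf _ (hne t)) with hm
  have hinj : Set.InjOn m (P.roots.toFinset : Set ℂ) := by
    intro t _ t' _ h
    rw [hm, Projectivization.mk_eq_mk_iff] at h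
    obtain ⟨c, hc⟩ := h
    obtain ⟨r, hr, -⟩ := hF.exists_smul_eq hW hg hbf (hne t') c.ne_zero hc.symm
    have h0 := congrArg (fun v : AffSp 2 => v 0) hr
    have h1 := congrArg (fun v : AffSp 2 => v 1) hr
    simp at h0 h1
    rw [h1, ← h0, one_mul]
  have himage : {p : CP n | p ∈ W ∧ ∑ i, a i * p.rep.ofLp i = 0} =
      m '' (P.roots.toFinset : Set ℂ) := by
    ext p
    simp only [Set.mem_ofPred_eq, Set.mem_image, Finset.mem_coe, hroot]
    constructor
    · rintro ⟨hp, hap⟩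
      obtain ⟨x, hx⟩ := hF.exists_evalForms_eq hbf (rep_mem_affineCone hp)
      have hx0 : x 0 ≠ 0 := by
        intro h0
        have hx' : x = x 1 • !₂[0, 1] := by ext i; fin_cases i <;> simp [h0]
        have h1 : x 1 ≠ 0 := by
          intro h1
          rw [h1, zero_smul] at hx'
          rw [hx', ← zero_smul ℂ (0 : AffSp 2), evalForms_smul hF.homog,
            zero_pow (degree_ne_zero_of_cross hF.homog hF.cross hF.gen), zero_smul] at hx
          exact p.rep_nonzero hx.symm
        rw [← hx, ← eval_pullbackLinear, hx', WithLp.ofLp_smul, eval_smul_of_isHomogeneous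
          (isHomogeneous_pullbackLinear hF.homog a)] at hap
        apply ha
        rw [hP, coeff_dehomogenize (isHomogeneous_pullbackLinear hF.homog a)]
        exact (mul_eq_zero.1 hap).resolve_left (pow_ne_zero e h1)
      have hxt : (!₂[1, x 1 / x 0] : AffSp 2) = (x 0)⁻¹ • x := by
        ext i
        fin_cases i <;> simp [hx0, div_eq_inv_mul]
      refine ⟨x 1 / x 0, ?_, ?_⟩
      · rw [hxt, evalForms_smul hF.homog, hx]
        simp only [PiLp.smul_apply, smul_eq_mul]
        rw [← mul_zero (((x 0)⁻¹) ^ e), ← hap, Finset.mul_sum]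
        exact Finset.sum_congr rfl fun i _ => by ring
      · rw [hm]
        conv_rhs => rw [← p.mk_rep]
        rw [Projectivization.mk_eq_mk_iff']
        exact ⟨((x 0)⁻¹) ^ e, by rw [← hx, ← evalForms_smul hF.homog, hxt]⟩
    · rintro ⟨t, ht, rfl⟩
      refine ⟨(mem_affineCone_iff _).1 (hF.mem _), ?_⟩
      obtain ⟨c, hc⟩ := Projectivization.exists_smul_eq_mk_rep ℂ _ (hbf _ (hne t))
      rw [hm]
      simp only
      rw [← hc]
      change ∑ i, a i * ((c : ℂ) * evalForms F !₂[1, t] i) = 0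
      rw [← mul_zero (c : ℂ), ← ht, Finset.mul_sum]
      exact Finset.sum_congr rfl fun i _ => by ring
  rw [himage, hinj.encard_image, Set.encard_coe_eq_coe_finsetCard]

/-- The degree of a curve is the degree of the forms in a base-point free parametrization. -/
theorem IsParam.degree_eq (hW : IsSmoothCurve W) (hg : ∀ j, (g j).IsHomogeneous b)
    (hF : IsParam W g e F) (hbf : ∀ x : AffSp 2, x ≠ 0 → evalForms F x ≠ 0) {d : ℕ}
    (hd : HasDegree W d) : e = d := by
  obtain ⟨G, hG, hGd⟩ := hd
  have he := degree_ne_zero_of_cross hF.homog hF.cross hF.gen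
  have hne : ∀ t : ℂ, (!₂[1, t] : AffSp 2) ≠ 0 := by
    intro t h
    simpa using congrArg (fun v : AffSp 2 => v 0) h
  have hne' : (!₂[0, 1] : AffSp 2) ≠ 0 := by
    intro h
    simpa using congrArg (fun v : AffSp 2 => v 1) h
  -- The hyperplane `u` is general for `G` and misses `F (0, 1)`, so that `U` has degree exactly
  -- `e`.
  obtain ⟨u, hu⟩ := exists_eval_ne_zero (mul_ne_zero hG (linear_ne_zero (hbf _ hne')))
  rw [map_mul, mul_ne_zero_iff] at hu
  set U := dehomogenize (pullbackLinear F u) with hU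
  have hUe : U.coeff e ≠ 0 := by
    rw [hU, coeff_dehomogenize (isHomogeneous_pullbackLinear hF.homog u)]
    have := hu.2
    rw [map_sum] at this
    simp only [map_mul, eval_C, eval_X] at this
    have h2 := eval_pullbackLinear F u !₂[0, 1]
    change eval ![0, 1] _ = _ at h2
    rw [h2]
    simpa [mul_comm] using this
  have hUdeg : U.natDegree = e := le_antisymm
    (natDegree_dehomogenize_le (isHomogeneous_pullbackLinear hF.homog u))
    (Polynomial.le_natDegree_of_ne_zero hUe)
  have hU0 : U ≠ 0 := by
    rintro h
    rw [h, Polynomial.coeff_zero] at hUe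
    exact hUe rfl
  -- The hyperplane `v` misses the images of the roots of `U`, so the pencil has no base point.
  obtain ⟨v, hv⟩ := exists_eval_ne_zero (σ := Fin (n + 1)) (K := ℂ)
    (P := ∏ t ∈ U.roots.toFinset, ∑ i, C (evalForms F !₂[1, t] i) * X i)
    (Finset.prod_ne_zero_iff.2 fun t _ => linear_ne_zero (hbf _ (hne t)))
  rw [map_prod, Finset.prod_ne_zero_iff] at hv
  set V := dehomogenize (pullbackLinear F v) with hV
  have hUV : ∀ t, U.eval t = 0 → V.eval t ≠ 0 := by
    intro t ht
    have h1 := hv t (by rw [Multiset.mem_toFinset, Polynomial.mem_roots hU0]; exact ht)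
    rw [map_sum] at h1
    simp only [map_mul, eval_C, eval_X] at h1
    have h2 := eval_pullbackLinear F v !₂[1, t]
    change eval ![1, t] _ = _ at h2
    rw [hV, eval_dehomogenize, h2]
    simpa [mul_comm] using h1
  obtain ⟨B, hB, hBs⟩ := Polynomial.exists_finite_card_roots_pencil he hUdeg
    (natDegree_dehomogenize_le (isHomogeneous_pullbackLinear hF.homog v)) hUV
  -- For this `s` the hyperplane `u + s v` is still general for `G` and its pulled-back form has `e`
  -- distinct roots.
  obtain ⟨s, hs⟩ := (hB.union (finite_eval_pencil_eq_zero hu.1 v)).exists_notMem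
  simp only [Set.mem_union, Set.mem_ofPred_eq, not_or] at hs
  obtain ⟨hs1, hs2⟩ := hBs s hs.1
  have hpencil : U + Polynomial.C s * V = dehomogenize (pullbackLinear F (u + s • v)) := by
    rw [hU, hV, ← Polynomial.smul_eq_C_mul, ← map_smul, ← map_add]
    congr 1
    simp only [pullbackLinear, Finset.smul_sum, ← Finset.sum_add_distrib, smul_eq_C_mul,
      Pi.add_apply, Pi.smul_apply, smul_eq_mul, C_add, C_mul]
    exact Finset.sum_congr rfl fun i _ => by ring
  rw [hpencil] at hs1 hs2
  have h1 := hF.encard_hyperplane_section hW hg hbf hs1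
  rw [hs2, hGd _ hs.2] at h1
  exact_mod_cast h1.symm

end

end

noncomputable section

open Filter Topology

/-! ### Manifolds -/

section

variable {E H : Type*} [NormedAddCommGroup E] [NormedSpace ℝ E] [TopologicalSpace H]
  {M N : Type*} [TopologicalSpace M] [TopologicalSpace N]

/-- The manifold structure of `M` transported to `N` along a homeomorphism. -/
@[reducible]
def Homeomorph.transportChartedSpace [ChartedSpace H M] (h : M ≃ₜ N) : ChartedSpace H N where
  atlas := (fun e => h.symm.toOpenPartialHomeomorph.trans e) '' atlas H M
  chartAt y := h.symm.toOpenPartialHomeomorph.trans (chartAt H (h.symm y))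
  mem_chart_source y := by simp
  chart_mem_atlas y := ⟨_, chart_mem_atlas H _, rfl⟩

/-- With transported charts, the transition maps are those of `M` and `h` reads as the identity. -/
theorem exists_chartedSpace_diffeomorph (I : ModelWithCorners ℝ E H) (n : WithTop ℕ∞)
    [ChartedSpace H M] [IsManifold I n M] (h : M ≃ₜ N) :
    ∃ _ : ChartedSpace H N, IsManifold I n N ∧ ∃ Φ : M ≃ₘ^n⟮I, I⟯ N, ∀ x, Φ x = h x := by
  let _ := h.transportChartedSpace (H := H)
  have hch : ∀ y : N, chartAt H y =
    h.symm.toOpenPartialHomeomorph.trans (chartAt H (h.symm y)) := fun _ => rfl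
  have hN : IsManifold I n N := by
    have : HasGroupoid N (contDiffGroupoid n I) := by
      refine ⟨?_⟩
      rintro _ _ ⟨e, he, rfl⟩ ⟨e', he', rfl⟩
      refine (contDiffGroupoid n I).mem_of_eqOnSource
        (HasGroupoid.compatible (G := contDiffGroupoid n I) he he') ⟨?_, ?_⟩
      · ext x
        simp
      · intro x _
        simp
    exact IsManifold.mk' I n N
  refine ⟨inferInstance, hN, ⟨h.toEquiv, ?_, ?_⟩, fun _ => rfl⟩
  · intro x
    rw [contMDiffAt_iff_target]
    refine ⟨h.continuous.continuousAt, ?_⟩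
    have h1 : extChartAt I (h x) ∘ h = extChartAt I x := by
      ext y
      simp [extChartAt, hch]
    change ContMDiffAt _ _ _ (extChartAt I (h x) ∘ h) x
    rw [h1]
    exact contMDiffAt_extChartAt
  · intro y
    rw [contMDiffAt_iff_target]
    refine ⟨h.symm.continuous.continuousAt, ?_⟩
    have h1 : extChartAt I (h.symm y) ∘ h.symm = extChartAt I y := by
      ext y
      simp [extChartAt, hch]
    change ContMDiffAt _ _ _ (extChartAt I (h.symm y) ∘ h.symm) y
    rw [h1]
    exact contMDiffAt_extChartAt

end

/-- An analytic map with injective derivative at a point is an immersion there. -/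
theorem isImmersionAtOfComplement_of_mfderiv_injective {E F G M : Type*}
    [NormedAddCommGroup E] [NormedSpace ℝ E] [FiniteDimensional ℝ E]
    [NormedAddCommGroup F] [NormedSpace ℝ F] [FiniteDimensional ℝ F]
    [NormedAddCommGroup G] [NormedSpace ℝ G] [FiniteDimensional ℝ G]
    [TopologicalSpace M] [ChartedSpace E M] [IsManifold 𝓘(ℝ, E) ω M]
    (hdim : Module.finrank ℝ E + Module.finrank ℝ F = Module.finrank ℝ G) {f : M → G} {x : M}
    (hf : ContMDiffAt 𝓘(ℝ, E) 𝓘(ℝ, G) ω f x)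
    (hinj : Function.Injective (mfderiv 𝓘(ℝ, E) 𝓘(ℝ, G) f x)) :
    Manifold.IsImmersionAtOfComplement F 𝓘(ℝ, E) 𝓘(ℝ, G) ∞ f x := by
  have : CompleteSpace E := FiniteDimensional.complete ℝ E
  have : CompleteSpace F := FiniteDimensional.complete ℝ F
  have hG : ∀ y : G, chartAt G y = OpenPartialHomeomorph.refl G := fun _ => rfl
  set φ := chartAt E x with hφ
  set g : E → G := f ∘ φ.symm with hg
  set u₀ := φ x with hu₀
  have hgc : ContDiffAt ℝ ω g u₀ := by
    have := (contMDiffAt_iff.1 hf).2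
    simpa [extChartAt, hg, hφ, hu₀, hG, contDiffWithinAt_univ] using this
  set L : E →L[ℝ] G := fderiv ℝ g u₀ with hL
  have hLinj : Function.Injective L := by
    have h1 : mfderiv 𝓘(ℝ, E) 𝓘(ℝ, G) f x = L := by
      rw [(hf.mdifferentiableAt (by simp)).mfderiv]
      simp [writtenInExtChartAt, extChartAt, hL, hg, hφ, hu₀, hG]
      rfl
    intro a b hab
    apply hinj
    rw [h1]
    exact hab
  obtain ⟨K, hK⟩ := Submodule.exists_isCompl (L : E →ₗ[ℝ] G).range
  have hKdim : Module.finrank ℝ F = Module.finrank ℝ K := by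
    have h1 := Submodule.finrank_add_eq_of_isCompl hK
    rw [LinearMap.finrank_range_of_inj hLinj] at h1
    omega
  obtain ⟨κ⟩ := FiniteDimensional.nonempty_linearEquiv_of_finrank_eq hKdim
  set k : F →L[ℝ] G := (K.subtype ∘ₗ κ.toLinearMap).toContinuousLinearMap with hk
  set T : E × F →L[ℝ] G := L.coprod k with hT
  have hTinj : Function.Injective T := by
    rw [injective_iff_map_eq_zero]
    rintro ⟨a, c⟩ hac
    have hac' : L a + (κ c : G) = 0 := hac
    have h1 : L a ∈ (L : E →ₗ[ℝ] G).range ⊓ K := by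
      refine ⟨⟨a, rfl⟩, ?_⟩
      rw [eq_neg_of_add_eq_zero_left hac']
      exact K.neg_mem (κ c).2
    rw [hK.inf_eq_bot, Submodule.mem_bot] at h1
    have ha : a = 0 := hLinj (by rw [h1, map_zero])
    rw [h1, zero_add] at hac'
    have hc : c = 0 := by simpa using hac'
    rw [ha, hc]
    rfl
  set equiv : (E × F) ≃L[ℝ] G := (LinearEquiv.ofInjectiveOfFinrankEq (T : E × F →ₗ[ℝ] G) hTinj
    (by rw [Module.finrank_prod, hdim])).toContinuousLinearEquiv with hequiv
  have hequivT : (equiv : E × F →L[ℝ] G) = T := by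
    ext <;> rfl
  -- Thickening `g` by a complement of the image of its derivative gives a local diffeomorphism; its
  -- inverse straightens `f`, sending `g u` to `(u, 0)`.
  set Θ : E × F → G := fun p => g p.1 + k p.2 with hΘ
  have hΘc : ContDiffAt ℝ ω Θ (u₀, 0) :=
    (ContDiffAt.comp (u₀, (0 : F)) (f := Prod.fst) hgc contDiffAt_fst).add
      (k.contDiff.contDiffAt.comp (u₀, (0 : F)) contDiffAt_snd)
  have hΘd : HasFDerivAt Θ (equiv : E × F →L[ℝ] G) (u₀, 0) := by
    rw [hequivT]
    have h1 : HasFDerivAt g L (u₀, (0 : F)).1 := (hgc.differentiableAt (by simp)).hasFDerivAt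
    have h2 := (h1.comp (u₀, (0 : F)) hasFDerivAt_fst).add
      (k.hasFDerivAt.comp (u₀, (0 : F)) hasFDerivAt_snd)
    exact h2
  set Ψ := hΘc.toOpenPartialHomeomorph Θ hΘd (by simp) with hΨ
  have hΨs : (u₀, (0 : F)) ∈ Ψ.source := hΘc.mem_toOpenPartialHomeomorph_source hΘd (by simp)
  have hΨc : ∀ p, Ψ p = Θ p := fun p => rfl
  have hA : ∀ᶠ p in 𝓝 (u₀, (0 : F)), ContDiffAt ℝ ω Θ p := hΘc.eventually (by simp)
  have hB : ∀ᶠ p in 𝓝 (u₀, (0 : F)), ContDiffAt ℝ ω Ψ.symm (Θ p) :=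
    hΘc.continuousAt.eventually ((hΘc.to_localInverse hΘd (by simp)).eventually (by simp))
  -- Membership in the maximal atlas requires analyticity of `Θ` and of its inverse on the whole
  -- chart domain, so both are shrunk accordingly.
  obtain ⟨S, hS, hSo, hS0⟩ := eventually_nhds_iff.1 (hA.and hB)
  set Ψ' := Ψ.restrOpen S hSo with hΨ'
  have hsrc : Ψ'.source = Ψ.source ∩ S := Ψ.restrOpen_source S hSo
  have hmem0 : (u₀, (0 : F)) ∈ Ψ'.source := by
    rw [hsrc]
    exact ⟨hΨs, hS0⟩
  have hΨ'c : ∀ p, Ψ' p = Θ p := fun p => rfl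
  have hΨ's : ∀ q, Ψ'.symm q = Ψ.symm q := fun q => rfl
  set codChart : OpenPartialHomeomorph G G :=
    Ψ'.symm.trans equiv.toHomeomorph.toOpenPartialHomeomorph with hcod
  have hcodsrc : codChart.source = Ψ'.target := by simp [hcod]
  have hcodAtlas : codChart ∈ IsManifold.maximalAtlas 𝓘(ℝ, G) ω G := by
    apply OpenPartialHomeomorph.mem_maximalAtlas_of_contMDiffOn
    · intro q hq
      rw [hcodsrc] at hq
      have h1 := Ψ'.map_target hq
      have h3 : Θ (Ψ'.symm q) = q := Ψ'.right_inv hq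
      rw [hsrc] at h1
      have h2 := (hS _ h1.2).2
      rw [h3] at h2
      exact (equiv.contDiff.contDiffAt.comp q h2).contMDiffAt.contMDiffWithinAt
    · intro v hv
      have hv' : equiv.symm v ∈ Ψ'.source := by simpa [hcod] using hv
      rw [hsrc] at hv'
      exact (((hS _ hv'.2).1).comp v equiv.symm.contDiff.contDiffAt).contMDiffAt.contMDiffWithinAt
  set V : Set E := {u | (u, (0 : F)) ∈ Ψ'.source} with hV
  have hVo : IsOpen V := Ψ'.open_source.preimage (by fun_prop)
  set domChart := φ.trans (OpenPartialHomeomorph.ofSet V hVo) with hdom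
  have hdomAtlas : domChart ∈ IsManifold.maximalAtlas 𝓘(ℝ, E) ω M := by
    apply OpenPartialHomeomorph.mem_maximalAtlas_of_contMDiffOn
    · exact (contMDiffOn_chart (I := 𝓘(ℝ, E)) (n := ω) (x := x)).mono fun y hy => hy.1
    · exact (contMDiffOn_chart_symm (I := 𝓘(ℝ, E)) (n := ω) (x := x)).mono fun y hy => hy.2
  refine Manifold.IsImmersionAtOfComplement.mk_of_continuousAt hf.continuousAt equiv domChart
    codChart ?_ ?_ (IsManifold.maximalAtlas_subset_of_le le_top hdomAtlas)
    (IsManifold.maximalAtlas_subset_of_le le_top hcodAtlas) ?_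
  · simp [hdom, hV, hφ]
    exact hmem0
  · rw [hcodsrc]
    have := Ψ'.map_source hmem0
    rw [hΨ'c] at this
    simpa [hΘ, hg, hφ, hu₀] using this
  · intro u hu
    have huV : (u, (0 : F)) ∈ Ψ'.source := by
      simp [hdom, hV] at hu
      exact hu.1
    have h1 : Ψ'.symm (g u) = (u, 0) := by
      have := Ψ'.left_inv huV
      rw [hΨ'c] at this
      simpa [hΘ] using this
    simp [hcod, hdom]
    exact h1

/-- Regularity and immersivity of a map can be tested after composition with a local
diffeomorphism. -/
theorem IsLocalDiffeomorphAt.contMDiffAt_and_mfderiv_injective_of_comp {E H E' H' E'' H'' : Type*}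
    [NormedAddCommGroup E] [NormedSpace ℝ E] [TopologicalSpace H] {I : ModelWithCorners ℝ E H}
    [NormedAddCommGroup E'] [NormedSpace ℝ E'] [TopologicalSpace H'] {J : ModelWithCorners ℝ E' H'}
    [NormedAddCommGroup E''] [NormedSpace ℝ E''] [TopologicalSpace H'']
    {K : ModelWithCorners ℝ E'' H''} {M N P : Type*} [TopologicalSpace M] [ChartedSpace H M]
    [TopologicalSpace N] [ChartedSpace H' N] [TopologicalSpace P] [ChartedSpace H'' P]
    {n : WithTop ℕ∞} (hn : n ≠ 0)
    {f : N → P} {ρ : M → N} {x : M} (hρ : IsLocalDiffeomorphAt I J n ρ x)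
    (hf : ContMDiffAt I K n (f ∘ ρ) x) (hinj : Function.Injective (mfderiv I K (f ∘ ρ) x)) :
    ContMDiffAt J K n f (ρ x) ∧ Function.Injective (mfderiv J K f (ρ x)) := by
  have h1 : ContMDiffAt J K n f (ρ x) := by
    have h2 : hρ.localInverse (ρ x) = x := hρ.localInverse_left_inv hρ.localInverse_mem_target
    have h3 : ContMDiffAt J K n ((f ∘ ρ) ∘ hρ.localInverse) (ρ x) :=
      ContMDiffAt.comp (ρ x) (by rw [h2]; exact hf) hρ.localInverse_contMDiffAt
    refine h3.congr_of_eventuallyEq ?_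
    filter_upwards [hρ.localInverse_eventuallyEq_right] with y hy
    have hy' : ρ (hρ.localInverse y) = y := hy
    simp [hy']
  refine ⟨h1, ?_⟩
  rw [mfderiv_comp x (h1.mdifferentiableAt hn) (hρ.mdifferentiableAt hn)] at hinj
  intro u v huv
  obtain ⟨u, rfl⟩ := (hρ.mfderivToContinuousLinearEquiv hn).surjective u
  obtain ⟨v, rfl⟩ := (hρ.mfderivToContinuousLinearEquiv hn).surjective v
  rw [hinj huv]

end

noncomputable section

open MvPolynomial Filter Topology

/-! ### The link of the affine cone -/

section

variable {n : ℕ} {W : Set (CP n)} {b e : ℕ} {g : Fin 2 → CoordRing n}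
  {F : Fin (n + 1) → CoordRing 1}

/-- The normalization `x ↦ F(x) / ‖F(x)‖` of a tuple of forms. -/
def normalizedForms (F : Fin (n + 1) → CoordRing 1) (x : AffSp 2) : AffSp (n + 1) :=
  ‖evalForms F x‖⁻¹ • evalForms F x

theorem S3.ne_zero (x : S3) : (x : AffSp 2) ≠ 0 := ne_zero_of_mem_unit_sphere x

theorem norm_normalizedForms {x : AffSp 2} (hx : evalForms F x ≠ 0) :
    ‖normalizedForms F x‖ = 1 := by
  rw [normalizedForms, norm_smul, norm_inv, norm_norm, inv_mul_cancel₀ (norm_ne_zero_iff.2 hx)]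

theorem IsParam.normalizedForms_mem_link (hF : IsParam W g e F) {x : AffSp 2}
    (hx : evalForms F x ≠ 0) : normalizedForms F x ∈ link W := by
  refine ⟨?_, norm_normalizedForms hx⟩
  have := smul_mem_affineCone (hF.mem x) ((‖evalForms F x‖⁻¹ : ℝ) : ℂ)
  rwa [Complex.coe_smul] at this

theorem contDiffAt_normalizedForms {x : AffSp 2} (hx : evalForms F x ≠ 0) :
    ContDiffAt ℝ ω (normalizedForms F) x := by
  have h1 : ContDiffAt ℝ ω (evalForms F) x := ((contDiff_evalForms F).restrict_scalars ℝ).contDiffAt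
  exact ((h1.norm ℂ hx).inv (norm_ne_zero_iff.2 hx)).smul h1

/-- The normalized parametrization has only the radial direction in the kernel of its derivative. -/
theorem IsParam.fderiv_normalizedForms_eq_zero (hW : IsSmoothCurve W)
    (hg : ∀ j, (g j).IsHomogeneous b) (hF : IsParam W g e F) {x : AffSp 2} (hx0 : x ≠ 0)
    (hx : evalForms F x ≠ 0) {v : AffSp 2} (hv : fderiv ℝ (normalizedForms F) x v = 0) :
    ∃ r : ℝ, v = r • x := by
  have he := degree_ne_zero_of_cross hF.homog hF.cross hF.gen
  have h0 : ContDiffAt ℝ ω (evalForms F) x := ((contDiff_evalForms F).restrict_scalars ℝ).contDiffAt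
  have h1 : HasFDerivAt (evalForms F) ((fderiv ℂ (evalForms F) x).restrictScalars ℝ) x :=
    ((contDiff_evalForms F).differentiable (by simp) x).hasFDerivAt.restrictScalars ℝ
  have h2 : DifferentiableAt ℝ (fun y => ‖evalForms F y‖⁻¹) x :=
    ((h0.norm ℂ hx).inv (norm_ne_zero_iff.2 hx)).differentiableAt (by simp)
  have h3 := (h2.hasFDerivAt.smul h1).fderiv
  change fderiv ℝ (normalizedForms F) x = _ at h3
  rw [h3] at hv
  set c := fderiv ℝ (fun y => ‖evalForms F y‖⁻¹) x v with hc
  have h4 : ‖evalForms F x‖⁻¹ • fderiv ℂ (evalForms F) x v + c • evalForms F x = 0 := hv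
  -- The derivative of `F` sends `v` to `-‖F x‖ c F(x)` and, by Euler, `x` to `e F(x)`; its
  -- injectivity forces this ratio.
  set r : ℝ := -(‖evalForms F x‖ * c) / e with hr
  have he' : (e : ℝ) ≠ 0 := by exact_mod_cast he
  refine ⟨r, ?_⟩
  apply hF.fderiv_injective hW hg hx0 hx
  have h5 : fderiv ℂ (evalForms F) x v = -(‖evalForms F x‖ * c) • evalForms F x := by
    have h6 := congrArg (fun y => ‖evalForms F x‖ • y) h4
    simp only [smul_add, smul_smul, smul_zero, mul_inv_cancel₀ (norm_ne_zero_iff.2 hx),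
      one_smul] at h6
    rw [neg_smul]
    exact eq_neg_of_add_eq_zero_left h6
  rw [h5, ← Complex.coe_smul r x, map_smul, fderiv_evalForms_self hF.homog, smul_smul,
    ← Complex.coe_smul]
  congr 1
  rw [hr]
  push_cast
  have he'' : (e : ℂ) ≠ 0 := by exact_mod_cast he
  field_simp

/-- The parametrization of the link by the sphere. -/
def sphereToLink (hF : IsParam W g e F) (hbf : ∀ x : AffSp 2, x ≠ 0 → evalForms F x ≠ 0)
    (x : S3) : link W :=
  ⟨normalizedForms F x, hF.normalizedForms_mem_link (hbf x x.ne_zero)⟩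

variable (hF : IsParam W g e F) (hbf : ∀ x : AffSp 2, x ≠ 0 → evalForms F x ≠ 0)

theorem contMDiff_coe_sphereToLink :
    ContMDiff (𝓡 3) 𝓘(ℝ, AffSp (n + 1)) ω (fun x => (sphereToLink hF hbf x : AffSp (n + 1))) :=
  fun x => (contDiffAt_normalizedForms (hbf x x.ne_zero)).contMDiffAt.comp x
    contMDiff_coe_sphere.contMDiffAt

theorem continuous_sphereToLink : Continuous (sphereToLink hF hbf) :=
  (contMDiff_coe_sphereToLink hF hbf).continuous.subtype_mk _

/-- The kernel of the derivative of `normalizedForms F` is radial, and the tangent space of the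
sphere is orthogonal to the radius. -/
theorem injective_mfderiv_coe_sphereToLink (hW : IsSmoothCurve W)
    (hg : ∀ j, (g j).IsHomogeneous b) (x : S3) :
    Function.Injective (mfderiv (𝓡 3) 𝓘(ℝ, AffSp (n + 1))
      (fun x => (sphereToLink hF hbf x : AffSp (n + 1))) x) := by
  have hd : DifferentiableAt ℝ (normalizedForms F) x :=
    (contDiffAt_normalizedForms (hbf x x.ne_zero)).differentiableAt (by simp)
  have h1 : mfderiv (𝓡 3) 𝓘(ℝ, AffSp (n + 1))
      (fun x => (sphereToLink hF hbf x : AffSp (n + 1))) x =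
      (fderiv ℝ (normalizedForms F) x).comp
        (mfderiv (𝓡 3) 𝓘(ℝ, AffSp 2) (Subtype.val : S3 → AffSp 2) x) := by
    have := mfderiv_comp x (I := 𝓡 3) (I' := 𝓘(ℝ, AffSp 2)) (I'' := 𝓘(ℝ, AffSp (n + 1)))
      (f := (Subtype.val : S3 → AffSp 2)) (g := normalizedForms F) hd.mdifferentiableAt
      ((contMDiff_coe_sphere (m := 1) x).mdifferentiableAt one_ne_zero)
    rw [mfderiv_eq_fderiv] at this
    exact this
  rw [h1]
  have h2 := injective_mvfderiv_subtypeVal_sphere (n := 3) x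
  have h3 := range_mvfderiv_subtypeVal (n := 3) x
  set D : EuclideanSpace ℝ (Fin 3) →L[ℝ] AffSp 2 :=
    mvfderiv (𝓡 3) (Subtype.val : S3 → AffSp 2) x
  change Function.Injective (fun v => fderiv ℝ (normalizedForms F) x (D v))
  have h4 : ∀ v, fderiv ℝ (normalizedForms F) x (D v) = 0 → v = 0 := by
    intro v hv
    obtain ⟨r, hr⟩ := hF.fderiv_normalizedForms_eq_zero hW hg x.ne_zero (hbf x x.ne_zero) hv
    have h5 : D v ∈ (Submodule.span ℝ {(x : AffSp 2)})ᗮ := by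
      rw [← h3]
      exact ⟨v, rfl⟩
    rw [Submodule.mem_orthogonal_singleton_iff_inner_right, hr, real_inner_smul_right,
      real_inner_self_eq_norm_sq, norm_eq_of_mem_sphere, one_pow, mul_one] at h5
    rw [h5, zero_smul] at hr
    exact h2 (hr.trans (map_zero D).symm)
  intro u v huv
  rw [← sub_eq_zero]
  apply h4
  rw [map_sub, map_sub]
  exact sub_eq_zero.2 huv

/-- A preimage of `y` under `F` may be scaled to norm one: this multiplies `F` by a positive real,
which the normalization removes. -/
theorem surjective_sphereToLink : Function.Surjective (sphereToLink hF hbf) := by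
  rintro ⟨y, hy, hy1⟩
  have he := degree_ne_zero_of_cross hF.homog hF.cross hF.gen
  obtain ⟨x, rfl⟩ := hF.exists_evalForms_eq hbf hy
  have hx : x ≠ 0 := by
    rintro rfl
    rw [← zero_smul ℂ (0 : AffSp 2), evalForms_smul hF.homog, zero_pow he, zero_smul,
      norm_zero] at hy1
    exact zero_ne_one hy1
  have hx' : ‖x‖ ≠ 0 := norm_ne_zero_iff.2 hx
  refine ⟨⟨‖x‖⁻¹ • x, by simp [norm_smul, hx']⟩, Subtype.ext ?_⟩
  have h1 : evalForms F (‖x‖⁻¹ • x) = (‖x‖⁻¹ ^ e) • evalForms F x := by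
    rw [← Complex.coe_smul, evalForms_smul hF.homog, ← Complex.coe_smul]
    push_cast
    rfl
  change normalizedForms F (‖x‖⁻¹ • x) = evalForms F x
  have h2 : 0 < ‖x‖⁻¹ ^ e := by positivity
  rw [normalizedForms, h1, norm_smul, hy1, mul_one, Real.norm_of_nonneg h2.le, smul_smul,
    inv_mul_cancel₀ h2.ne', one_smul]

/-- Equal normalizations mean `F x = c F y` with `c > 0`, so `x = a y` with `a ^ e = c`. Unit norms
give `‖a‖ = 1`, hence `c = 1` and `a` is an `e`-th root of unity; `lensRotation e 1` is
multiplication by a primitive one. -/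
theorem sphereToLink_eq_iff [NeZero e] (hW : IsSmoothCurve W) (hg : ∀ j, (g j).IsHomogeneous b)
    (x y : S3) : sphereToLink hF hbf x = sphereToLink hF hbf y ↔ lensMk e 1 x = lensMk e 1 y := by
  have he : e ≠ 0 := NeZero.ne e
  rw [lensMk_eq_iff, Subtype.ext_iff]
  change normalizedForms F x = normalizedForms F y ↔ _
  have hexp : ∀ z : AffSp 2, ∀ k : ℕ, (lensRotation e 1 ^ k) z =
      Complex.exp (2 * Real.pi * Complex.I / e) ^ k • z := by
    intro z k
    rw [lensRotation_pow_apply]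
    ext i
    fin_cases i <;> simp
  constructor
  · intro h
    have hx := norm_ne_zero_iff.2 (hbf x x.ne_zero)
    have hy := norm_ne_zero_iff.2 (hbf y y.ne_zero)
    set c : ℝ := ‖evalForms F x‖ * ‖evalForms F y‖⁻¹ with hc
    have hc0 : 0 < c := by positivity
    have h1 : evalForms F x = (c : ℂ) • evalForms F y := by
      have := congrArg (fun v => ‖evalForms F x‖ • v) h
      simp only [normalizedForms, smul_smul, mul_inv_cancel₀ hx, one_smul] at this
      rw [Complex.coe_smul]
      exact this
    obtain ⟨a, hxa, ha⟩ := hF.exists_smul_eq hW hg hbf y.ne_zero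
      (Complex.ofReal_ne_zero.2 hc0.ne') h1
    have hna : ‖a‖ = 1 := by
      have := congrArg norm hxa
      rwa [norm_smul, norm_eq_of_mem_sphere, norm_eq_of_mem_sphere, mul_one, eq_comm] at this
    have hc1 : c = 1 := by
      have := congrArg norm ha
      rw [norm_pow, hna, one_pow, Complex.norm_real, Real.norm_of_nonneg hc0.le] at this
      exact this.symm
    rw [hc1, Complex.ofReal_one] at ha
    obtain ⟨k, -, hk⟩ := (Complex.isPrimitiveRoot_exp e he).eq_pow_of_pow_eq_one ha
    refine ⟨⟨lensRotation e 1 ^ k, Subgroup.npow_mem_zpowers _ k⟩, Subtype.ext ?_⟩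
    change (lensRotation e 1 ^ k) (y : AffSp 2) = x
    rw [hexp, hk, hxa]
  · rintro ⟨⟨u, hu⟩, rfl⟩
    obtain ⟨k, rfl⟩ := (isOfFinOrder_iff_pow_eq_one.2
      ⟨e, NeZero.pos e, lensRotation_pow_self e 1⟩).mem_powers_iff_mem_zpowers.2 hu
    change normalizedForms F ((lensRotation e 1 ^ k) (y : AffSp 2)) = _
    rw [hexp, normalizedForms, normalizedForms, evalForms_smul hF.homog, ← pow_mul, mul_comm k e,
      pow_mul, (Complex.isPrimitiveRoot_exp e he).pow_eq_one, one_pow, one_smul]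

/-- The lens space `L(e, 1)` is homeomorphic to the link. -/
theorem exists_homeomorph_lensSpace_link [NeZero e] (hW : IsSmoothCurve W)
    (hg : ∀ j, (g j).IsHomogeneous b) :
    ∃ h : LensSpace e 1 ≃ₜ link W, ∀ x, h (lensMk e 1 x) = sphereToLink hF hbf x := by
  have hiff := sphereToLink_eq_iff hF hbf hW hg
  set q : LensSpace e 1 → link W := Quotient.lift (sphereToLink hF hbf) fun x y hxy =>
    (hiff x y).2 (Quotient.sound hxy) with hq
  have hqmk : ∀ x, q (lensMk e 1 x) = sphereToLink hF hbf x := fun _ => rfl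
  have hbij : Function.Bijective q := by
    constructor
    · intro a c
      obtain ⟨x, rfl⟩ := Quotient.exists_rep a
      obtain ⟨y, rfl⟩ := Quotient.exists_rep c
      exact (hiff x y).1
    · intro y
      obtain ⟨x, rfl⟩ := surjective_sphereToLink hF hbf y
      exact ⟨lensMk e 1 x, rfl⟩
  have hcont : Continuous q := (continuous_sphereToLink hF hbf).quotient_lift _
  have : CompactSpace (LensSpace e 1) := Quotient.compactSpace
  exact ⟨Continuous.homeoOfEquivCompactToT2 (f := Equiv.ofBijective q hbij) hcont, hqmk⟩

end

end

/-- The link of the affine cone over a smooth rational curve of degree `d` in `ℂPⁿ`, with the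
smooth structure that makes it an embedded submanifold of `ℂⁿ⁺¹`, is diffeomorphic to `L(d, 1)`. -/
theorem theorem3p4 (n d : ℕ) [NeZero d] (W : Set (CP n))
    (hW : IsSmoothRationalCurve W) (hd : HasDegree W d) :
    ∃ _ : ChartedSpace (EuclideanSpace ℝ (Fin 3)) (link W),
      IsManifold (𝓡 3) ∞ (link W) ∧
      Manifold.IsSmoothEmbedding (𝓡 3) 𝓘(ℝ, AffSp (n + 1)) ∞ (Subtype.val : link W → AffSp (n + 1)) ∧
      Nonempty (link W ≃ₘ⟮𝓡 3, 𝓡 3⟯ LensSpace d 1) := by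
  obtain ⟨b, e, g, F, hg, hF, hbf⟩ := exists_isParam_basepointFree hW.isSmooth.1 hW.isRational
  obtain rfl := hF.degree_eq hW.isSmooth hg hbf hd
  obtain ⟨h, hh⟩ := exists_homeomorph_lensSpace_link hF hbf hW.isSmooth hg
  obtain ⟨C, hC, Φ, hΦ⟩ := exists_chartedSpace_diffeomorph (𝓡 3) ω h
  -- The Jacobian criterion at any point gives `n ≥ 1`, so the codimension `2 * (n + 1) - 3` below
  -- is not truncated.
  have hdim : 3 ≤ 2 * (n + 1) := by
    obtain ⟨p, hp⟩ := nonempty_of_isPrime_idealOf hW.isSmooth.1.isPrime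
    have := hW.isSmooth.2 p hp
    omega
  have himm : Manifold.IsImmersionOfComplement (EuclideanSpace ℝ (Fin (2 * (n + 1) - 3))) (𝓡 3)
      𝓘(ℝ, AffSp (n + 1)) ∞ (Subtype.val : link W → AffSp (n + 1)) := by
    intro y
    obtain ⟨x, rfl⟩ := surjective_sphereToLink hF hbf y
    -- The inclusion is tested on `S³`, where it becomes the normalized parametrization.
    have hρ : IsLocalDiffeomorphAt (𝓡 3) (𝓡 3) ω (Φ ∘ lensMk e 1) x :=
      IsLocalDiffeomorphAt.comp (hf := isLocalDiffeomorph_lensMk e 1 x)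
        (hg := Φ.isLocalDiffeomorph _)
    have hρx : ∀ x, (Φ ∘ lensMk e 1) x = sphereToLink hF hbf x := fun x => by
      rw [Function.comp_apply, hΦ, hh]
    have hcomp : (Subtype.val : link W → AffSp (n + 1)) ∘ (Φ ∘ lensMk e 1) =
        fun x => (sphereToLink hF hbf x : AffSp (n + 1)) := funext fun x => by
      rw [Function.comp_apply, hρx]
    obtain ⟨h1, h2⟩ := hρ.contMDiffAt_and_mfderiv_injective_of_comp (K := 𝓘(ℝ, AffSp (n + 1)))
      (f := (Subtype.val : link W → AffSp (n + 1))) (by simp)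
      (by rw [hcomp]; exact contMDiff_coe_sphereToLink hF hbf x)
      (by rw [hcomp]; exact injective_mfderiv_coe_sphereToLink hF hbf hW.isSmooth hg x)
    rw [hρx] at h1 h2
    refine isImmersionAtOfComplement_of_mfderiv_injective ?_ h1 h2
    rw [finrank_euclideanSpace_fin, finrank_euclideanSpace_fin,
      ← Module.finrank_mul_finrank ℝ ℂ (AffSp (n + 1)), Complex.finrank_real_complex,
      finrank_euclideanSpace_fin]
    omega
  exact ⟨C, IsManifold.of_le (n := ω) le_top,
    ⟨himm.isImmersion, Topology.IsEmbedding.subtypeVal⟩,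
    ⟨⟨Φ.symm.toEquiv, Φ.symm.contMDiff.of_le le_top, Φ.contMDiff.of_le le_top⟩⟩⟩
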